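/- Let $1\le k<d$, let $\xi:\mathbb R^d\to\mathbb R^k$ be $C^\infty$, and let $\Sigma=\{x\in\mathbb R^d:\xi(x)=0\}$. Write $\nabla\xi(x)\in\mathbb R^{d\times k}$ for the matrix with entries $(\nabla\xi(x))_{ij}=\partial_i\xi_j(x)$. Assume that $\Sigma$ is compact and that $\nabla\xi(x)^T\nabla\xi(x)$ is positive definite for every $x\in\Sigma$. Let $\overline V:\mathbb R^d\to\mathbb R$ be $C^2$, let $M\in\mathbb R^{d\times d}$ be symmetric positive definite, and let $\tau>0$. Put $$T^*_x\Sigma=\{p\in\mathbb R^d:\nabla\xi(x)^TM^{-1}p=0\},\qquad T^*\Sigma=\{(x,p)\in\mathbb R^d\times\mathbb R^d:\ x\in\Sigma,\ p\in T_x^*\Sigma\},$$ and let $T^*\Sigma$ carry the Liouville measure $\sigma_{T^*\Sigma}(dx\,dp)=\sigma^M_\Sigma(dx)\,\sigma^{M^{-1}}_{T^*_x\Sigma}(dp)$, where $\sigma^M_\Sigma$ is the surface measure of $\Sigma$ induced by $\langle u,v\rangle_M=u^TMv$ and $\sigma^{M^{-1}}_{T^*_x\Sigma}$ is the Lebesgue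 measure of $T_x^*\Sigma$ induced by $\langle p,q\rangle_{M^{-1}}=p^TM^{-1}q$. For $z=(x,p)$ and $c_x,c_p\in\mathbb R^k$ let $F(z,c_x,c_p)=(\bar x,-\bar p)$ with $$\bar x=x+\tau M^{-1}p-\tfrac{\tau^2}{2}M^{-1}\nabla\overline V(x)+\tau M^{-1}\nabla\xi(x)c_x,$$ $$\bar p=p-\tfrac\tau2\big(\nabla\overline V(x)+\nabla\overline V(\bar x)\big)+\nabla\xi(x)c_x+\nabla\xi(\bar x)c_p .$$ For $z\in T^*\Sigma$ let $\mathcal F(z)=\{z'\in T^*\Sigma:\ \exists\,\lambda_x,\lambda_p\in\mathbb R^k,\ z'=F(z,\lambda_x,\lambda_p)\}$ be the set of outcomes of one step of RATTLE with momentum reversal. For $x,y\in\Sigma$ let $$P_M(x)=I_d-\nabla\xi(x)\big(\nabla\xi(x)^TM^{-1}\nabla\xi(x)\big)^{-1}\nabla\xi(x)^TM^{-1},\qquad G_{M,x}(y)=\tfrac1\tau P_M(x)M\Big(y-x+\tfrac{\tau^2}{2}M^{-1}\nabla\overline V(x)\Big),$$ $$C_{M,x}=\{y\in\Sigma:\det(\nabla\xi(y)^TM^{-1}\nabla\xi(x))=0\},\qquad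 \mathcal N=\{(x,p)\in T^*\Sigma:\ p\in G_{M,x}(C_{M,x})\}.$$ Then the following hold. 1. $\mathcal N$ is closed in $T^*\Sigma$, $\sigma_{T^*\Sigma}(\mathcal N)=0$, and $$\mathcal N=\{(x,p)\in T^*\Sigma:\ \exists\,(x^1,p^{1,-})\in\mathcal F(x,p),\ \det(\nabla\xi(x^1)^TM^{-1}\nabla\xi(x))=0\}.$$ 2. For every $z\in T^*\Sigma\setminus\mathcal N$ the set $\mathcal F(z)$ is finite (possibly empty). 3. Let $z\in T^*\Sigma\setminus\mathcal N$ and $\mathcal F(z)=\{z^{(1)},\dots,z^{(n)}\}$ with $n=|\mathcal F(z)|\ge1$. There are an open neighborhood $\mathcal O$ of $z$ in $T^*\Sigma$ and $n$ pairs of $C^1$ functions $\lambda_x^{(i)},\lambda_p^{(i)}:\mathcal O\to\mathbb R^k$ such that $z^{(i)}=F(z,\lambda^{(i)}_x(z),\lambda^{(i)}_p(z))$ for all $i$ and, for all $\bar z\in\mathcal O$, $$\mathcal F(\bar z)=\big\{F(\bar z,\lambda^{(i)}_x(\bar z),\lambda^{(i)}_p(\bar z)):1\le i\le n\big\},\qquad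 |\mathcal F(\bar z)|=n .$$ Moreover, for each $i$ there is a $C^1$ map $\Upsilon^{(i)}:\mathcal O\to\Sigma$ such that $\Upsilon^{(i)}(z)$ is the position component of $z^{(i)}$ and, for all $\bar z=(\bar x,\bar p)\in\mathcal O$, writing $y=\Upsilon^{(i)}(\bar z)$, one has $G_{M,\bar x}(y)=\bar p$ and $$\lambda_x^{(i)}(\bar z)=\tfrac1\tau\big[\nabla\xi(\bar x)^TM^{-1}\nabla\xi(\bar x)\big]^{-1}\nabla\xi(\bar x)^T\Big[y-\bar x-\tau M^{-1}\bar p+\tfrac{\tau^2}2M^{-1}\nabla\overline V(\bar x)\Big],$$ $$\lambda_p^{(i)}(\bar z)=-\big[\nabla\xi(y)^TM^{-1}\nabla\xi(y)\big]^{-1}\nabla\xi(y)^TM^{-1}\Big(\bar p-\tfrac\tau2\big(\nabla\overline V(\bar x)+\nabla\overline V(y)\big)+\nabla\xi(\bar x)\lambda_x^{(i)}(\bar z)\Big).$$ 4. Let $\mathcal B_0=\{z\in T^*\Sigma:|\mathcal F(z)|=0\}$ and $\mathcal B_i=\{z\in T^*\Sigma\setminus\mathcal N:|\mathcal F(z)|=i\}$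 for $i\ge1$. Then $\mathcal N,\mathcal B_0,\mathcal B_1,\dots$ are pairwise disjoint, $T^*\Sigma=\big(\bigcup_{i\ge0}\mathcal B_i\big)\cup\mathcal N$, and every $\mathcal B_i$ is open in $T^*\Sigma$. -/

import Mathlib

open MeasureTheory Matrix Set
open scoped MatrixOrder

namespace RattleHMC

noncomputable section

/-! ### The constraint manifold, its cotangent bundle and the RATTLE scheme

Points of `ℝ^d` are functions `Fin d → ℝ`; matrices act on them by `*ᵥ`. -/

/-- `∇ξ(x)`, the `d × k` matrix with entries `∂ξ_j/∂x_i (x)`. -/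
def gradXi {d k : ℕ} (ξ : (Fin d → ℝ) → (Fin k → ℝ)) (x : Fin d → ℝ) :
    Matrix (Fin d) (Fin k) ℝ :=
  Matrix.of fun i j => fderiv ℝ ξ x (Pi.single i 1) j

/-- The gradient of the potential. -/
def gradV {d : ℕ} (V : (Fin d → ℝ) → ℝ) (x : Fin d → ℝ) : Fin d → ℝ :=
  fun i => fderiv ℝ V x (Pi.single i 1)

/-- The level set `Σ = {x | ξ(x) = 0}`. -/
def levelSet {d k : ℕ} (ξ : (Fin d → ℝ) → (Fin k → ℝ)) : Set (Fin d → ℝ) :=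
  {x | ξ x = 0}

/-- The cotangent space `T*_xΣ = {p | ∇ξ(x)ᵀ M⁻¹ p = 0}`. -/
def cotangentSpace {d k : ℕ} (M : Matrix (Fin d) (Fin d) ℝ)
    (ξ : (Fin d → ℝ) → (Fin k → ℝ)) (x : Fin d → ℝ) : Set (Fin d → ℝ) :=
  {p | (gradXi ξ x)ᵀ *ᵥ (M⁻¹ *ᵥ p) = 0}

/-- The cotangent bundle `T*Σ ⊆ ℝ^d × ℝ^d`. -/
def cotangentBundle {d k : ℕ} (M : Matrix (Fin d) (Fin d) ℝ)
    (ξ : (Fin d → ℝ) → (Fin k → ℝ)) : Set ((Fin d → ℝ) × (Fin d → ℝ)) :=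
  {z | z.1 ∈ levelSet ξ ∧ z.2 ∈ cotangentSpace M ξ z.1}

/-- `P_M(x) = I - ∇ξ (∇ξᵀ M⁻¹ ∇ξ)⁻¹ ∇ξᵀ M⁻¹`. -/
def projM {d k : ℕ} (M : Matrix (Fin d) (Fin d) ℝ)
    (ξ : (Fin d → ℝ) → (Fin k → ℝ)) (x : Fin d → ℝ) : Matrix (Fin d) (Fin d) ℝ :=
  1 - gradXi ξ x * ((gradXi ξ x)ᵀ * M⁻¹ * gradXi ξ x)⁻¹ * (gradXi ξ x)ᵀ * M⁻¹

/-- `G_{M,x}(y) = (1/τ) P_M(x) M (y - x + (τ²/2) M⁻¹ ∇V(x))`. -/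
def GM {d k : ℕ} (M : Matrix (Fin d) (Fin d) ℝ) (ξ : (Fin d → ℝ) → (Fin k → ℝ))
    (V : (Fin d → ℝ) → ℝ) (τ : ℝ) (x y : Fin d → ℝ) : Fin d → ℝ :=
  (1 / τ) • (projM M ξ x *ᵥ (M *ᵥ (y - x + (τ ^ 2 / 2) • (M⁻¹ *ᵥ gradV V x))))

/-- `C_{M,x} = {y ∈ Σ | det (∇ξ(y)ᵀ M⁻¹ ∇ξ(x)) = 0}`. -/
def critSet {d k : ℕ} (M : Matrix (Fin d) (Fin d) ℝ)
    (ξ : (Fin d → ℝ) → (Fin k → ℝ)) (x : Fin d → ℝ) : Set (Fin d → ℝ) :=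
  {y | y ∈ levelSet ξ ∧ ((gradXi ξ y)ᵀ * M⁻¹ * gradXi ξ x).det = 0}

/-- The set `N = {(x,p) ∈ T*Σ | p ∈ G_{M,x}(C_{M,x})}`. -/
def badSet {d k : ℕ} (M : Matrix (Fin d) (Fin d) ℝ) (ξ : (Fin d → ℝ) → (Fin k → ℝ))
    (V : (Fin d → ℝ) → ℝ) (τ : ℝ) : Set ((Fin d → ℝ) × (Fin d → ℝ)) :=
  {z | z ∈ cotangentBundle M ξ ∧ z.2 ∈ GM M ξ V τ z.1 '' critSet M ξ z.1}

/-- Position component of the RATTLE map. -/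
def rattlePos {d k : ℕ} (M : Matrix (Fin d) (Fin d) ℝ) (ξ : (Fin d → ℝ) → (Fin k → ℝ))
    (V : (Fin d → ℝ) → ℝ) (τ : ℝ) (z : (Fin d → ℝ) × (Fin d → ℝ)) (cx : Fin k → ℝ) :
    Fin d → ℝ :=
  z.1 + τ • (M⁻¹ *ᵥ z.2) - (τ ^ 2 / 2) • (M⁻¹ *ᵥ gradV V z.1)
    + τ • (M⁻¹ *ᵥ (gradXi ξ z.1 *ᵥ cx))

/-- The map `F(x, p, c_x, c_p) = (x̄, -p̄)`, one step of RATTLE with momentum reversal with given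
values of the Lagrange multipliers. -/
def rattleMap {d k : ℕ} (M : Matrix (Fin d) (Fin d) ℝ) (ξ : (Fin d → ℝ) → (Fin k → ℝ))
    (V : (Fin d → ℝ) → ℝ) (τ : ℝ) (z : (Fin d → ℝ) × (Fin d → ℝ)) (cx cp : Fin k → ℝ) :
    (Fin d → ℝ) × (Fin d → ℝ) :=
  (rattlePos M ξ V τ z cx,
    -(z.2 - (τ / 2) • (gradV V z.1 + gradV V (rattlePos M ξ V τ z cx))
      + gradXi ξ z.1 *ᵥ cx + gradXi ξ (rattlePos M ξ V τ z cx) *ᵥ cp))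

/-- `𝓕(z)`, the set of all outcomes in `T*Σ` of one step of RATTLE with momentum reversal. -/
def outcomes {d k : ℕ} (M : Matrix (Fin d) (Fin d) ℝ) (ξ : (Fin d → ℝ) → (Fin k → ℝ))
    (V : (Fin d → ℝ) → ℝ) (τ : ℝ) (z : (Fin d → ℝ) × (Fin d → ℝ)) :
    Set ((Fin d → ℝ) × (Fin d → ℝ)) :=
  {z' | z' ∈ cotangentBundle M ξ ∧ ∃ lx lp : Fin k → ℝ, z' = rattleMap M ξ V τ z lx lp}

/-- The multiplier `λ_x` expressed through the new position `y`. -/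
def multX {d k : ℕ} (M : Matrix (Fin d) (Fin d) ℝ) (ξ : (Fin d → ℝ) → (Fin k → ℝ))
    (V : (Fin d → ℝ) → ℝ) (τ : ℝ) (z : (Fin d → ℝ) × (Fin d → ℝ)) (y : Fin d → ℝ) :
    Fin k → ℝ :=
  (1 / τ) • (((gradXi ξ z.1)ᵀ * M⁻¹ * gradXi ξ z.1)⁻¹ *ᵥ ((gradXi ξ z.1)ᵀ *ᵥ
    (y - z.1 - τ • (M⁻¹ *ᵥ z.2) + (τ ^ 2 / 2) • (M⁻¹ *ᵥ gradV V z.1))))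

/-- The multiplier `λ_p` expressed through the new position `y`. -/
def multP {d k : ℕ} (M : Matrix (Fin d) (Fin d) ℝ) (ξ : (Fin d → ℝ) → (Fin k → ℝ))
    (V : (Fin d → ℝ) → ℝ) (τ : ℝ) (z : (Fin d → ℝ) × (Fin d → ℝ)) (y : Fin d → ℝ) :
    Fin k → ℝ :=
  -(((gradXi ξ y)ᵀ * M⁻¹ * gradXi ξ y)⁻¹ *ᵥ ((gradXi ξ y)ᵀ *ᵥ (M⁻¹ *ᵥ
    (z.2 - (τ / 2) • (gradV V z.1 + gradV V y) + gradXi ξ z.1 *ᵥ multX M ξ V τ z y))))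

/-- The sets `B_0 = {z ∈ T*Σ | |𝓕(z)| = 0}` and `B_i = {z ∈ T*Σ \ N | |𝓕(z)| = i}`, `i ≥ 1`.
The cardinality is taken in `ℕ∞`, so that infinite sets are not counted as empty. -/
def branchSet {d k : ℕ} (M : Matrix (Fin d) (Fin d) ℝ) (ξ : (Fin d → ℝ) → (Fin k → ℝ))
    (V : (Fin d → ℝ) → ℝ) (τ : ℝ) : ℕ → Set ((Fin d → ℝ) × (Fin d → ℝ))
  | 0 => {z | z ∈ cotangentBundle M ξ ∧ (outcomes M ξ V τ z).encard = 0}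
  | i + 1 => {z | z ∈ cotangentBundle M ξ \ badSet M ξ V τ ∧
      (outcomes M ξ V τ z).encard = ((i + 1 : ℕ) : ℕ∞)}

/-- `C¹` functions on a subset of a Euclidean space (a relatively open subset of an embedded
submanifold, below): near each point of the subset the function is the restriction of a `C¹`
function on an open subset of the ambient space. -/
def IsC1On {E F : Type*} [NormedAddCommGroup E] [NormedSpace ℝ E] [NormedAddCommGroup F]
    [NormedSpace ℝ F] (f : E → F) (O : Set E) : Prop :=
  ∀ z ∈ O, ∃ U : Set E, IsOpen U ∧ z ∈ U ∧ ∃ g : E → F, ContDiffOn ℝ 1 g U ∧ EqOn f g (U ∩ O)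

/-! ### The Liouville measure -/

/-- The `m`-dimensional surface (Riemannian) measure on `S ⊆ ℝ^d` induced by the scalar product
`⟨u, v⟩_A = uᵀ A v` of a symmetric positive definite matrix `A`. The map `y ↦ A^{-1/2} y` is an
isometry from the standard Euclidean space onto `(ℝ^d, ⟨·,·⟩_A)`; it carries the `m`-dimensional
Hausdorff measure, normalized to agree with Lebesgue measure on `m`-dimensional subspaces. -/
def surfaceMeasure {d : ℕ} (A : Matrix (Fin d) (Fin d) ℝ) (m : ℕ) (S : Set (Fin d → ℝ)) :
    Measure (Fin d → ℝ) :=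
  (Measure.map (fun y : EuclideanSpace ℝ (Fin d) => (CFC.sqrt A)⁻¹ *ᵥ (WithLp.ofLp y))
    (Measure.euclideanHausdorffMeasure m)).restrict S

/-- The phase space Liouville measure
`σ_{T*Σ}(dx dp) = σ^M_Σ(dx) σ^{M⁻¹}_{T*_xΣ}(dp)`, where `σ^M_Σ` is the surface measure of `Σ` for
the scalar product of `M` and `σ^{M⁻¹}_{T*_xΣ}` is the Lebesgue measure of `T*_xΣ` for the scalar
product of `M⁻¹`. See `liouvilleMeasure_apply`. -/
def liouvilleMeasure {d k : ℕ} (M : Matrix (Fin d) (Fin d) ℝ)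
    (ξ : (Fin d → ℝ) → (Fin k → ℝ)) : Measure ((Fin d → ℝ) × (Fin d → ℝ)) :=
  (surfaceMeasure M (d - k) (levelSet ξ)).bind fun x =>
    (surfaceMeasure M⁻¹ (d - k) (cotangentSpace M ξ x)).map (Prod.mk x)

/-! #### The fibre measures depend measurably on the base point -/

theorem continuous_gradXi {d k : ℕ} {ξ : (Fin d → ℝ) → (Fin k → ℝ)} (hξ : ContDiff ℝ 1 ξ) :
    Continuous (gradXi ξ) := by
  refine continuous_matrix fun i j => ?_
  have h : Continuous fun x => fderiv ℝ ξ x (Pi.single i 1) :=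
    (hξ.continuous_fderiv (by simp)).clm_apply continuous_const
  exact (continuous_apply j).comp h

/-- Lebesgue measure of a subspace through tubes around it. -/
theorem subspace_measure_eq {d : ℕ} (W : Submodule ℝ (EuclideanSpace ℝ (Fin d)))
    {B : Set (EuclideanSpace ℝ (Fin d))} (hB : MeasurableSet B) :
    volume {q : EuclideanSpace ℝ (Fin d) | W.starProjection q ∈ B ∧
        ‖q - W.starProjection q‖ ≤ 1} =
      Measure.euclideanHausdorffMeasure (Module.finrank ℝ W) (B ∩ W) *
        volume (Metric.closedBall (0 : Wᗮ) 1) := by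
  have hmp := W.measurePreserving_measurableEquivProd (0 : EuclideanSpace ℝ (Fin d))
  have hB' : MeasurableSet ((Subtype.val : W → _) ⁻¹' B) := measurable_subtype_coe hB
  have h1 : {q : EuclideanSpace ℝ (Fin d) | W.starProjection q ∈ B ∧
        ‖q - W.starProjection q‖ ≤ 1} =
      W.measurableEquivProd (0 : EuclideanSpace ℝ (Fin d)) ⁻¹'
        (((Subtype.val : W → _) ⁻¹' B) ×ˢ Metric.closedBall (0 : Wᗮ) 1) := by
    ext q
    have : q - W.starProjection q = (Wᗮ.orthogonalProjectionOnto q : EuclideanSpace ℝ (Fin d)) := by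
      have := W.starProjection_add_starProjection_orthogonal q
      rw [sub_eq_iff_eq_add, add_comm]
      exact this.symm
    simp only [mem_ofPred_eq, this, mem_preimage, Submodule.measurableEquivProd_apply, mem_prod,
      vsub_eq_sub, sub_zero, mem_closedBall_zero_iff, Submodule.coe_norm]
    rfl
  have h2 : Measure.euclideanHausdorffMeasure (Module.finrank ℝ W) (B ∩ W) =
      volume ((Subtype.val : W → EuclideanSpace ℝ (Fin d)) ⁻¹' B) := by
    rw [← InnerProductSpace.euclideanHausdorffMeasure_eq_volume (V := W)]
    rw [isometry_subtype_coe.euclideanHausdorffMeasure_preimage]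
    simp
  rw [h1, h2, ← InnerProductSpace.euclideanHausdorffMeasure_eq_volume,
    hmp.measure_preimage (hB'.prod Metric.isClosed_closedBall.measurableSet).nullMeasurableSet,
    Measure.volume_eq_prod, Measure.prod_prod]

/-- The orthogonal projection onto the kernel of a matrix with full row rank. -/
theorem starProjection_ker {d k : ℕ} (L : Matrix (Fin k) (Fin d) ℝ) (hL : IsUnit (L * Lᵀ).det)
    (W : Submodule ℝ (EuclideanSpace ℝ (Fin d))) (hW : ∀ y, y ∈ W ↔ L *ᵥ (WithLp.ofLp y) = 0)
    (q : EuclideanSpace ℝ (Fin d)) :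
    W.starProjection q =
      WithLp.toLp 2 (WithLp.ofLp q - Lᵀ *ᵥ ((L * Lᵀ)⁻¹ *ᵥ (L *ᵥ (WithLp.ofLp q)))) := by
  refine (Submodule.eq_starProjection_of_mem_of_inner_eq_zero ?_ ?_)
  · rw [hW]
    simp only [mulVec_sub, mulVec_mulVec]
    rw [← Matrix.mul_assoc, ← Matrix.mul_assoc, Matrix.mul_nonsing_inv _ hL]
    simp
  · intro w hw
    rw [hW] at hw
    have : q - WithLp.toLp 2 (WithLp.ofLp q - Lᵀ *ᵥ ((L * Lᵀ)⁻¹ *ᵥ (L *ᵥ (WithLp.ofLp q)))) =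
        WithLp.toLp 2 (Lᵀ *ᵥ ((L * Lᵀ)⁻¹ *ᵥ (L *ᵥ (WithLp.ofLp q)))) := by
      ext i; simp
    rw [this, EuclideanSpace.inner_eq_star_dotProduct]
    simp only [star_trivial]
    rw [dotProduct_mulVec, vecMul_transpose, hw, zero_dotProduct]

theorem finrank_ker {d k : ℕ} (L : Matrix (Fin k) (Fin d) ℝ) (hL : IsUnit (L * Lᵀ).det)
    (W : Submodule ℝ (EuclideanSpace ℝ (Fin d))) (hW : ∀ y, y ∈ W ↔ L *ᵥ (WithLp.ofLp y) = 0) :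
    Module.finrank ℝ W + k = d := by
  let e := WithLp.linearEquiv 2 ℝ (Fin d → ℝ)
  let f : EuclideanSpace ℝ (Fin d) →ₗ[ℝ] (Fin k → ℝ) := L.mulVecLin ∘ₗ e.toLinearMap
  have hker : LinearMap.ker f = W := by
    ext y
    rw [hW, LinearMap.mem_ker]
    rfl
  have hsurj : Function.Surjective f := by
    intro c
    refine ⟨WithLp.toLp 2 (Lᵀ *ᵥ ((L * Lᵀ)⁻¹ *ᵥ c)), ?_⟩
    change L *ᵥ (Lᵀ *ᵥ ((L * Lᵀ)⁻¹ *ᵥ c)) = c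
    rw [mulVec_mulVec, mulVec_mulVec, Matrix.mul_nonsing_inv _ hL, one_mulVec]
  have h := f.finrank_range_add_finrank_ker
  rw [LinearMap.range_eq_top.2 hsurj, hker] at h
  simp only [finrank_top, Module.finrank_fintype_fun_eq_card, Fintype.card_fin,
    finrank_euclideanSpace] at h
  omega

/-- The measures `δ_x ⊗ σ^{M⁻¹}_{T*_xΣ}` depend measurably on `x ∈ Σ`. -/
theorem aemeasurable_fibre {d k : ℕ} {ξ : (Fin d → ℝ) → (Fin k → ℝ)} (hξ : ContDiff ℝ 1 ξ)
    (hrank : ∀ x ∈ levelSet ξ, ((gradXi ξ x)ᵀ * gradXi ξ x).PosDef)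
    {M : Matrix (Fin d) (Fin d) ℝ} (hM : M.PosDef) :
    AEMeasurable (fun x => (surfaceMeasure M⁻¹ (d - k) (cotangentSpace M ξ x)).map (Prod.mk x))
      (surfaceMeasure M (d - k) (levelSet ξ)) := by
  set T : Matrix (Fin d) (Fin d) ℝ := (CFC.sqrt M⁻¹)⁻¹ with hT
  have hTu : IsUnit T := by
    have h1 : (CFC.sqrt M⁻¹).det ≠ 0 := by
      rw [hM.inv.posSemidef.det_sqrt]
      have := hM.inv.det_pos
      rw [RCLike.sqrt_of_nonneg this.le]
      exact (Real.sqrt_pos.2 this).ne'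
    rw [hT, Matrix.isUnit_nonsing_inv_iff, Matrix.isUnit_iff_isUnit_det]
    exact h1.isUnit
  let Q : Matrix (Fin d) (Fin d) ℝ := M⁻¹ * T
  have hQu : IsUnit Q := (Matrix.isUnit_nonsing_inv_iff.2 hM.isUnit).mul hTu
  let L : (Fin d → ℝ) → Matrix (Fin k) (Fin d) ℝ := fun x => (gradXi ξ x)ᵀ * Q
  have hLc : Continuous L := (continuous_gradXi hξ).matrix_transpose.matrix_mul continuous_const
  let D : (Fin d → ℝ) → Matrix (Fin k) (Fin k) ℝ := fun x => L x * (L x)ᵀ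
  have hDc : Continuous D := hLc.matrix_mul hLc.matrix_transpose
  have hD : ∀ x ∈ levelSet ξ, IsUnit (D x).det := by
    intro x hx
    have hinj : Function.Injective (gradXi ξ x).mulVec := by
      intro a b hab
      have hu := (hrank x hx).isUnit
      refine Matrix.mulVec_injective_of_isUnit hu ?_
      simp only [← mulVec_mulVec]
      exact congrArg _ hab
    have hinj2 : Function.Injective (L x)ᵀ.mulVec := by
      have : (L x)ᵀ = Qᵀ * gradXi ξ x := by simp [L]
      rw [this]
      intro a b hab
      simp only [← mulVec_mulVec] at hab
      exact hinj (Matrix.mulVec_injective_of_isUnit ((Matrix.isUnit_transpose Q).2 hQu) hab)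
    have := Matrix.PosDef.conjTranspose_mul_self (L x)ᵀ hinj2
    have h2 : (D x).PosDef := by simpa [D, conjTranspose_eq_transpose_of_trivial] using this
    exact (h2.det_pos.ne').isUnit
  -- the projection, as a jointly measurable function
  let p : (Fin d → ℝ) × EuclideanSpace ℝ (Fin d) → EuclideanSpace ℝ (Fin d) := fun z =>
    WithLp.toLp 2 (WithLp.ofLp z.2 -
      ((D z.1).det)⁻¹ • ((L z.1)ᵀ *ᵥ ((D z.1).adjugate *ᵥ (L z.1 *ᵥ (WithLp.ofLp z.2)))))
  have hL1 : Continuous fun z : (Fin d → ℝ) × EuclideanSpace ℝ (Fin d) => L z.1 :=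
    hLc.comp continuous_fst
  have hD1 : Continuous fun z : (Fin d → ℝ) × EuclideanSpace ℝ (Fin d) => D z.1 :=
    hDc.comp continuous_fst
  have hz2 : Continuous fun z : (Fin d → ℝ) × EuclideanSpace ℝ (Fin d) => WithLp.ofLp z.2 :=
    (PiLp.continuous_ofLp 2 _).comp continuous_snd
  have hp : Measurable p := by
    refine (PiLp.continuous_toLp 2 _).measurable.comp (hz2.measurable.sub ?_)
    refine (hD1.matrix_det.measurable.inv).smul ?_
    exact (hL1.matrix_transpose.matrix_mulVec
      (hD1.matrix_adjugate.matrix_mulVec (hL1.matrix_mulVec hz2))).measurable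
  -- the space in isometric coordinates
  have hmapT : Measurable fun y : EuclideanSpace ℝ (Fin d) => T *ᵥ (WithLp.ofLp y) :=
    (continuous_const.matrix_mulVec (PiLp.continuous_ofLp 2 _)).measurable
  let c : ENNReal := volume (Metric.closedBall (0 : EuclideanSpace ℝ (Fin k)) 1)
  have hc0 : c ≠ 0 := (Metric.measure_closedBall_pos _ _ one_pos).ne'
  have hct : c ≠ ⊤ := (isCompact_closedBall _ _).measure_lt_top.ne
  let κ : (Fin d → ℝ) → Measure ((Fin d → ℝ) × (Fin d → ℝ)) := fun x =>
    c⁻¹ • ((volume.restrict {q | ‖q - p (x, q)‖ ≤ 1}).map fun q => (x, T *ᵥ WithLp.ofLp (p (x, q))))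
  have hS : MeasurableSet {z : (Fin d → ℝ) × EuclideanSpace ℝ (Fin d) | ‖z.2 - p z‖ ≤ 1} :=
    measurableSet_le (measurable_snd.sub hp).norm measurable_const
  have hpx : ∀ x, Measurable fun q => p (x, q) := fun x => hp.comp measurable_prodMk_left
  have hκv : ∀ x, ∀ A, MeasurableSet A → κ x A = c⁻¹ * volume
      {q | (x, T *ᵥ WithLp.ofLp (p (x, q))) ∈ A ∧ ‖q - p (x, q)‖ ≤ 1} := by
    intro x A hA
    have hm : Measurable fun q => (x, T *ᵥ WithLp.ofLp (p (x, q))) :=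
      measurable_const.prodMk (hmapT.comp (hpx x))
    simp only [κ, Measure.smul_apply, smul_eq_mul]
    rw [Measure.map_apply hm hA, Measure.restrict_apply (hm hA)]
    rfl
  have hκ : Measurable κ := by
    refine Measure.measurable_of_measurable_coe _ fun A hA => ?_
    simp only [hκv _ A hA]
    refine Measurable.const_mul ?_ _
    have hm : Measurable fun z : (Fin d → ℝ) × EuclideanSpace ℝ (Fin d) =>
      (z.1, T *ᵥ WithLp.ofLp (p z)) := measurable_fst.prodMk (hmapT.comp hp)
    exact measurable_measure_prodMk_left ((hm hA).inter hS)
  have hlev : MeasurableSet (levelSet ξ) :=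
    (isClosed_eq hξ.continuous continuous_const).measurableSet
  refine ⟨κ, hκ, ?_⟩
  rw [surfaceMeasure]
  filter_upwards [ae_restrict_mem hlev] with x hx
  ext A hA
  have hmk : Measurable (Prod.mk x : (Fin d → ℝ) → _) := measurable_prodMk_left
  have hcot : MeasurableSet (cotangentSpace M ξ x) :=
    (isClosed_eq (by fun_prop) continuous_const).measurableSet
  rw [hκv x A hA, Measure.map_apply hmk hA, surfaceMeasure, Measure.restrict_apply (hmk hA),
    Measure.map_apply hmapT ((hmk hA).inter hcot)]
  let W : Submodule ℝ (EuclideanSpace ℝ (Fin d)) :=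
    LinearMap.ker ((L x).mulVecLin ∘ₗ (WithLp.linearEquiv 2 ℝ (Fin d → ℝ)).toLinearMap)
  have hW : ∀ y, y ∈ W ↔ L x *ᵥ (WithLp.ofLp y) = 0 := fun y => Iff.rfl
  have hpq : ∀ q, p (x, q) = W.starProjection q := by
    intro q
    rw [starProjection_ker (L x) (hD x hx) W hW q]
    simp only [p]
    congr 2
    rw [Matrix.inv_def, Ring.inverse_eq_inv', smul_mulVec, mulVec_smul]
  have hfr := finrank_ker (L x) (hD x hx) W hW
  have hdk : d - k = Module.finrank ℝ W := by omega
  have hB : MeasurableSet ((fun y : EuclideanSpace ℝ (Fin d) => T *ᵥ (WithLp.ofLp y)) ⁻¹'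
      (Prod.mk x ⁻¹' A)) := hmapT (hmk hA)
  have key := subspace_measure_eq W hB
  have hball : volume (Metric.closedBall (0 : Wᗮ) 1) = c := by
    have hk : Module.finrank ℝ Wᗮ = k := by
      have := W.finrank_add_finrank_orthogonal
      simp only [finrank_euclideanSpace, Fintype.card_fin] at this
      omega
    have e : Wᗮ ≃ₗᵢ[ℝ] EuclideanSpace ℝ (Fin k) :=
      ((stdOrthonormalBasis ℝ Wᗮ).reindex (finCongr hk)).repr
    have := e.measurePreserving.measure_preimage
      (Metric.isClosed_closedBall (x := (0 : EuclideanSpace ℝ (Fin k)))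
        (ε := 1)).measurableSet.nullMeasurableSet
    refine Eq.trans ?_ this
    congr 1
    ext w
    simp
  rw [hball] at key
  simp only [hpq]
  have hset : (fun y : EuclideanSpace ℝ (Fin d) => T *ᵥ (WithLp.ofLp y)) ⁻¹'
      (Prod.mk x ⁻¹' A ∩ cotangentSpace M ξ x) =
      (fun y : EuclideanSpace ℝ (Fin d) => T *ᵥ (WithLp.ofLp y)) ⁻¹' (Prod.mk x ⁻¹' A) ∩ W := by
    ext y
    simp only [preimage_inter, mem_inter_iff, SetLike.mem_coe, hW]
    refine and_congr_right fun _ => ?_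
    simp [cotangentSpace, L, Q, mulVec_mulVec, Matrix.mul_assoc]
  rw [hset, hdk]
  have key2 : volume {q : EuclideanSpace ℝ (Fin d) |
      (x, T *ᵥ WithLp.ofLp (W.starProjection q)) ∈ A ∧ ‖q - W.starProjection q‖ ≤ 1} = _ := key
  rw [key2, mul_comm, mul_assoc, ENNReal.mul_inv_cancel hc0 hct, mul_one]

/-- The tensor form of the Liouville measure. -/
theorem liouvilleMeasure_apply {d k : ℕ} {ξ : (Fin d → ℝ) → (Fin k → ℝ)} (hξ : ContDiff ℝ 1 ξ)
    (hrank : ∀ x ∈ levelSet ξ, ((gradXi ξ x)ᵀ * gradXi ξ x).PosDef)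
    {M : Matrix (Fin d) (Fin d) ℝ} (hM : M.PosDef)
    {A : Set ((Fin d → ℝ) × (Fin d → ℝ))} (hA : MeasurableSet A) :
    liouvilleMeasure M ξ A = ∫⁻ x, surfaceMeasure M⁻¹ (d - k) (cotangentSpace M ξ x)
      {p | (x, p) ∈ A} ∂(surfaceMeasure M (d - k) (levelSet ξ)) := by
  rw [liouvilleMeasure, Measure.bind_apply hA (aemeasurable_fibre hξ hrank hM)]
  refine lintegral_congr fun x => ?_
  rw [Measure.map_apply measurable_prodMk_left hA]
  rfl

end

end RattleHMC

/-!
The proof replaces outcomes by position multipliers. For a state `z = (x, p)` of `T*Σ` the momentum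
multiplier is determined by the new position, and the new position `y` and the multiplier `c`
determine each other (`multX_rattlePos`, `outcomes_eq_image`). So `𝓕(z)` corresponds to the solution
set of the `k` equations `ξ (rattlePos z c) = 0` in the `k` unknowns `c`, which make sense for every
`z` in the ambient space. Their derivative in `c` is `τ ∇ξ(y)ᵀ M⁻¹ ∇ξ(x)` (`hasFDerivAt_constraint`),
and a state of `T*Σ` lies in the degenerate set `N` exactly if this matrix is singular at some
solution (`mem_badSet_iff`).

Outside `N` the implicit function theorem therefore presents the solutions near each given one as
the graph of a `C¹` function of `z` (`exists_multiplier_branch`). Since every solution is a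
continuous function of its new position, which ranges over the compact set `Σ`, the solutions form a
finite set (`finite_multiplierSet`), and no solutions other than those on the branches appear near
`z` (`exists_multiplier_branches`). Thus the number of outcomes is locally constant.

The set `N` is the image of a compact subset of `Σ × Σ`, hence closed (`isCompact_badSet`). Its fibre
over `x` is the set of critical values of `G_{M,x} : Σ → T*_xΣ`, a map between manifolds of the same
dimension: a kernel vector `c` of `∇ξ(y)ᵀ M⁻¹ ∇ξ(x)` yields the vector `M⁻¹ ∇ξ(x) c`, which is tangent
to `Σ` at `y` and killed by the derivative of `G_{M,x}`. By Sard's theorem in equal dimensions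
(`hausdorffMeasure_image_critical_levelSet_eq_zero`) the fibre is null, and so is `N` by the tensor
form of the Liouville measure.
-/

namespace RattleHMC

/-! ### Sard's theorem on a level set, in equal dimensions -/

section Sard

open Module Topology Filter

variable {E F W : Type*} [NormedAddCommGroup E] [NormedSpace ℝ E] [FiniteDimensional ℝ E]
  [NormedAddCommGroup F] [NormedSpace ℝ F] [FiniteDimensional ℝ F]
  [NormedAddCommGroup W] [NormedSpace ℝ W] [FiniteDimensional ℝ W]

/-- A surjection `D` can be completed by a map `q` into any space of the complementary dimension to
an isomorphism `(D, q)`. -/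
theorem exists_continuousLinearEquiv_prod_of_surjective (D : E →L[ℝ] F) (hD : Function.Surjective D)
    (hdim : finrank ℝ W + finrank ℝ F = finrank ℝ E) :
    ∃ q : E →L[ℝ] W, ∃ e : E ≃L[ℝ] F × W, (e : E →L[ℝ] F × W) = D.prod q := by
  have hker : finrank ℝ (LinearMap.ker (D : E →ₗ[ℝ] F)) = finrank ℝ W := by
    have h := (D : E →ₗ[ℝ] F).finrank_range_add_finrank_ker
    rw [LinearMap.range_eq_top.2 hD, finrank_top] at h
    omega
  obtain ⟨q, hq⟩ := LinearMap.exists_extend (LinearEquiv.ofFinrankEq _ _ hker).toLinearMap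
  have hinj : Function.Injective ((D : E →ₗ[ℝ] F).prod q) := by
    rw [injective_iff_map_eq_zero]
    intro v hv
    obtain ⟨h1, h2⟩ := Prod.ext_iff.1 hv
    have h3 := LinearMap.congr_fun hq ⟨v, h1⟩
    have h4 : (LinearEquiv.ofFinrankEq _ _ hker) ⟨v, h1⟩ = 0 := h3.symm.trans h2
    exact congrArg Subtype.val ((LinearEquiv.map_eq_zero_iff _).1 h4)
  refine ⟨LinearMap.toContinuousLinearMap q,
    (LinearMap.linearEquivOfInjective _ hinj (by simp; omega)).toContinuousLinearEquiv, ?_⟩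
  ext v <;> rfl

/-- Local form of Sard's theorem: in a chart `(f, q)` the level set becomes a slice, and the theorem
reduces to the one for maps `W → W`, which needs no more than differentiability. -/
theorem exists_nhds_hausdorffMeasure_image_critical_eq_zero
    [MeasurableSpace W] [BorelSpace W] {f : E → F} {g : E → W} {a : E}
    (hf : ContDiffAt ℝ 1 f a) (hfa : Function.Surjective (fderiv ℝ f a))
    (hg : Differentiable ℝ g) (hdim : finrank ℝ W + finrank ℝ F = finrank ℝ E) :
    ∃ t ∈ 𝓝 a, Measure.hausdorffMeasure (finrank ℝ W : ℝ) (g '' {y | y ∈ t ∧ f y = f a ∧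
      ∃ v ≠ 0, fderiv ℝ f y v = 0 ∧ fderiv ℝ g y v = 0}) = 0 := by
  obtain ⟨q, e, he⟩ := exists_continuousLinearEquiv_prod_of_surjective (W := W) _ hfa hdim
  have hΦ : ContDiffAt ℝ 1 (fun y => (f y, q y)) a := hf.prodMk q.contDiff.contDiffAt
  have hΦ' : HasFDerivAt (fun y => (f y, q y)) (e : E →L[ℝ] F × W) a := by
    rw [he]
    exact (hf.differentiableAt (by simp)).hasFDerivAt.prodMk q.hasFDerivAt
  let h := hΦ.toOpenPartialHomeomorph _ hΦ' (by simp)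
  have hcoe : ∀ y, h y = (f y, q y) := fun y => rfl
  have has : a ∈ h.source := hΦ.mem_toOpenPartialHomeomorph_source hΦ' (by simp)
  have hsymm : ContDiffAt ℝ 1 h.symm (h a) := hΦ.to_localInverse hΦ' (by simp)
  refine ⟨{y | y ∈ h.source ∧ DifferentiableAt ℝ f y ∧ DifferentiableAt ℝ h.symm (h y)}, ?_, ?_⟩
  · filter_upwards [h.open_source.mem_nhds has, hf.eventually (by simp),
      (h.continuousAt has).eventually (hsymm.eventually (by simp))] with y h1 h2 h3
    exact ⟨h1, h2.differentiableAt (by simp), h3.differentiableAt (by simp)⟩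
  set S := {y | y ∈ {y | y ∈ h.source ∧ DifferentiableAt ℝ f y ∧
    DifferentiableAt ℝ h.symm (h y)} ∧ f y = f a ∧
      ∃ v ≠ 0, fderiv ℝ f y v = 0 ∧ fderiv ℝ g y v = 0} with hS
  -- In the chart `y ↦ (f y, q y)` the level set is the slice `{f a} × W`.
  let ψ : W → E := fun w => h.symm (f a, w)
  have hψ : ∀ y ∈ S, ψ (q y) = y := by
    rintro y ⟨⟨hy, -⟩, hya, -⟩
    have := h.left_inv hy
    rwa [hcoe, hya] at this
  have himg : g '' S = (g ∘ ψ) '' (q '' S) := by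
    rw [image_image]
    exact image_congr fun y hy => by rw [Function.comp, hψ y hy]
  rw [himg]
  refine addHaar_image_eq_zero_of_det_fderivWithin_eq_zero _
    (f' := fun w => (fderiv ℝ g (ψ w)).comp ((fderiv ℝ h.symm (f a, w)).comp
      (ContinuousLinearMap.inr ℝ F W))) ?_ ?_
  · rintro _ ⟨y, hy, rfl⟩
    have h1 : DifferentiableAt ℝ h.symm (f a, q y) := by
      have := hy.1.2.2
      rwa [hcoe, hy.2.1] at this
    have h2 : HasFDerivAt (fun w : W => (f a, w)) (ContinuousLinearMap.inr ℝ F W) (q y) :=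
      hasFDerivAt_prodMk_right _ _
    exact (((hg _).hasFDerivAt).comp (q y)
      (h1.hasFDerivAt.comp (q y) h2)).hasFDerivWithinAt
  · rintro _ ⟨y, hy, rfl⟩
    obtain ⟨v, hv0, hfv, hgv⟩ := hy.2.2
    have hd : HasFDerivAt h ((fderiv ℝ f y).prod q) y :=
      hy.1.2.1.hasFDerivAt.prodMk q.hasFDerivAt
    have hinv : (fderiv ℝ h.symm (h y)) (0, q v) = v := by
      have h1 := hy.1.2.2.hasFDerivAt.comp y hd
      have h2 : HasFDerivAt (h.symm ∘ h) (ContinuousLinearMap.id ℝ E) y := by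
        refine (hasFDerivAt_id y).congr_of_eventuallyEq ?_
        filter_upwards [h.open_source.mem_nhds hy.1.1] with x hx
        exact h.left_inv hx
      have h3 := congrArg (fun l => l v) (h1.unique h2)
      simpa [hfv] using h3
    rw [hcoe, hy.2.1] at hinv
    -- `q v` spans a kernel direction of the derivative of `g ∘ ψ`, and `q v ≠ 0` because the inverse
    -- chart maps `(0, q v)` to `v`.
    by_contra hdet
    have hinj := (LinearMap.equivOfDetNeZero _ hdet).injective
    refine hv0 ?_
    have hq0 : q v = 0 := by
      apply hinj
      rw [map_zero]
      change (fderiv ℝ g (ψ (q y))) ((fderiv ℝ h.symm (f a, q y)) (0, q v)) = 0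
      rw [hinv, hψ y hy, hgv]
    rw [← hinv, hq0]
    exact map_zero _

/-- Sard's theorem for a map from a compact regular level set to a space of the same dimension: a
point of the level set is critical if the derivative of `g` kills a nonzero tangent vector. -/
theorem hausdorffMeasure_image_critical_levelSet_eq_zero
    [MeasurableSpace W] [BorelSpace W] {f : E → F} {g : E → W} {c : F}
    (hf : ContDiff ℝ 1 f) (hc : IsCompact {y | f y = c})
    (hfa : ∀ y, f y = c → Function.Surjective (fderiv ℝ f y))
    (hg : Differentiable ℝ g) (hdim : finrank ℝ W + finrank ℝ F = finrank ℝ E) :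
    Measure.hausdorffMeasure (finrank ℝ W : ℝ) (g '' {y | f y = c ∧
      ∃ v ≠ 0, fderiv ℝ f y v = 0 ∧ fderiv ℝ g y v = 0}) = 0 := by
  have key := hc.induction_on (p := fun s => Measure.hausdorffMeasure (finrank ℝ W : ℝ)
    (g '' {y | y ∈ s ∧ f y = c ∧ ∃ v ≠ 0, fderiv ℝ f y v = 0 ∧ fderiv ℝ g y v = 0}) = 0)
    (by simp) (fun s t hst ht => by
      refine measure_mono_null (image_mono fun y hy => ?_) ht
      exact And.intro (hst hy.1) hy.2)
    (fun s t hs ht => by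
      refine measure_mono_null ?_ (measure_union_null hs ht)
      rintro _ ⟨y, ⟨hy | hy, hy'⟩, rfl⟩
      exacts [Or.inl ⟨y, ⟨hy, hy'⟩, rfl⟩, Or.inr ⟨y, ⟨hy, hy'⟩, rfl⟩])
    (fun y hy => by
      obtain ⟨t, ht, h0⟩ := exists_nhds_hausdorffMeasure_image_critical_eq_zero (g := g)
        hf.contDiffAt (hfa y hy) hg hdim
      rw [show f y = c from hy] at h0
      exact ⟨t, mem_nhdsWithin_of_mem_nhds ht, h0⟩)
  refine measure_mono_null (image_mono fun y hy => ?_) key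
  exact And.intro hy.1 hy

end Sard

/-! ### Regularity of matrix expressions

Matrices carry no global norm, so regularity of matrix-valued maps is stated entrywise. -/

section Regularity

variable {E : Type*} [NormedAddCommGroup E] [NormedSpace ℝ E] {n : WithTop ℕ∞} {a : E}
  {l m r : Type*} [Fintype m]

theorem contDiffAt_mul_apply {A : E → Matrix l m ℝ} {B : E → Matrix m r ℝ}
    (hA : ∀ i j, ContDiffAt ℝ n (fun x => A x i j) a)
    (hB : ∀ i j, ContDiffAt ℝ n (fun x => B x i j) a) (i : l) (j : r) :
    ContDiffAt ℝ n (fun x => (A x * B x) i j) a := by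
  simp only [Matrix.mul_apply]
  exact ContDiffAt.sum fun s _ => (hA i s).mul (hB s j)

theorem contDiffAt_mulVec [Fintype l] {A : E → Matrix l m ℝ} {v : E → m → ℝ}
    (hA : ∀ i j, ContDiffAt ℝ n (fun x => A x i j) a) (hv : ContDiffAt ℝ n v a) :
    ContDiffAt ℝ n (fun x => A x *ᵥ v x) a := by
  rw [contDiffAt_pi] at hv ⊢
  intro i
  simp only [Matrix.mulVec, dotProduct]
  exact ContDiffAt.sum fun s _ => (hA i s).mul (hv s)

theorem contDiffAt_det [DecidableEq m] {A : E → Matrix m m ℝ}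
    (hA : ∀ i j, ContDiffAt ℝ n (fun x => A x i j) a) :
    ContDiffAt ℝ n (fun x => (A x).det) a := by
  simp only [Matrix.det_apply']
  exact ContDiffAt.sum fun σ _ => contDiffAt_const.mul (contDiffAt_prod fun i _ => hA _ _)

theorem contDiffAt_inv_apply [DecidableEq m] {A : E → Matrix m m ℝ}
    (hA : ∀ i j, ContDiffAt ℝ n (fun x => A x i j) a) (h0 : (A a).det ≠ 0) (i j : m) :
    ContDiffAt ℝ n (fun x => (A x)⁻¹ i j) a := by
  simp only [Matrix.inv_def, Ring.inverse_eq_inv', Matrix.smul_apply, smul_eq_mul,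
    Matrix.adjugate_apply]
  refine ((contDiffAt_det hA).inv h0).mul (contDiffAt_det fun s t => ?_)
  simp only [Matrix.updateRow_apply]
  split_ifs
  · exact contDiffAt_const
  · exact hA s t

end Regularity

/-! ### Regularity of the scheme -/

section SchemeRegularity

variable {d k : ℕ} {M : Matrix (Fin d) (Fin d) ℝ} {ξ : (Fin d → ℝ) → (Fin k → ℝ)}
  {V : (Fin d → ℝ) → ℝ} {τ : ℝ}
  {E : Type*} [NormedAddCommGroup E] [NormedSpace ℝ E] {a : E}

theorem contDiffAt_gradXi_apply (hξ : ContDiff ℝ 2 ξ) {x : E → Fin d → ℝ}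
    (hx : ContDiffAt ℝ 1 x a) (i : Fin d) (j : Fin k) :
    ContDiffAt ℝ 1 (fun u => gradXi ξ (x u) i j) a := by
  have h : ContDiff ℝ 1 fun y => fderiv ℝ ξ y (Pi.single i 1) :=
    (hξ.fderiv_right (by norm_num)).clm_apply contDiff_const
  exact (contDiff_pi.1 h j).contDiffAt.comp a hx

theorem contDiffAt_gradXi_transpose_apply (hξ : ContDiff ℝ 2 ξ) {x : E → Fin d → ℝ}
    (hx : ContDiffAt ℝ 1 x a) (i : Fin k) (j : Fin d) :
    ContDiffAt ℝ 1 (fun u => (gradXi ξ (x u))ᵀ i j) a :=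
  contDiffAt_gradXi_apply hξ hx j i

theorem contDiffAt_gradV (hV : ContDiff ℝ 2 V) {x : E → Fin d → ℝ}
    (hx : ContDiffAt ℝ 1 x a) : ContDiffAt ℝ 1 (fun u => gradV V (x u)) a := by
  have h : ContDiff ℝ 1 (gradV V) := contDiff_pi.2 fun i =>
    (hV.fderiv_right (by norm_num)).clm_apply contDiff_const
  exact h.contDiffAt.comp a hx

theorem contDiffAt_const_mulVec {l m : ℕ} (A : Matrix (Fin l) (Fin m) ℝ) {v : E → Fin m → ℝ}
    (hv : ContDiffAt ℝ 1 v a) : ContDiffAt ℝ 1 (fun u => A *ᵥ v u) a :=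
  contDiffAt_mulVec (fun _ _ => contDiffAt_const) hv

theorem contDiffAt_crossGram_apply (hξ : ContDiff ℝ 2 ξ) {x y : E → Fin d → ℝ}
    (hx : ContDiffAt ℝ 1 x a) (hy : ContDiffAt ℝ 1 y a) (i j : Fin k) :
    ContDiffAt ℝ 1 (fun u => ((gradXi ξ (y u))ᵀ * M⁻¹ * gradXi ξ (x u)) i j) a :=
  contDiffAt_mul_apply (A := fun u => (gradXi ξ (y u))ᵀ * M⁻¹) (B := fun u => gradXi ξ (x u))
    (contDiffAt_mul_apply (A := fun u => (gradXi ξ (y u))ᵀ) (B := fun _ => M⁻¹)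
      (contDiffAt_gradXi_transpose_apply hξ hy) fun _ _ => contDiffAt_const)
    (contDiffAt_gradXi_apply hξ hx) i j

theorem contDiffAt_rattlePos (hξ : ContDiff ℝ 2 ξ) (hV : ContDiff ℝ 2 V)
    {z : E → (Fin d → ℝ) × (Fin d → ℝ)} {c : E → Fin k → ℝ}
    (hz : ContDiffAt ℝ 1 z a) (hc : ContDiffAt ℝ 1 c a) :
    ContDiffAt ℝ 1 (fun u => rattlePos M ξ V τ (z u) (c u)) a := by
  unfold rattlePos
  exact ((hz.fst.add ((contDiffAt_const_mulVec _ hz.snd).const_smul τ)).sub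
    ((contDiffAt_const_mulVec _ (contDiffAt_gradV hV hz.fst)).const_smul _)).add
    ((contDiffAt_const_mulVec _
      (contDiffAt_mulVec (contDiffAt_gradXi_apply hξ hz.fst) hc)).const_smul τ)

theorem contDiffAt_multX (hξ : ContDiff ℝ 2 ξ) (hV : ContDiff ℝ 2 V)
    {z : E → (Fin d → ℝ) × (Fin d → ℝ)} {y : E → Fin d → ℝ}
    (hz : ContDiffAt ℝ 1 z a) (hy : ContDiffAt ℝ 1 y a)
    (h0 : ((gradXi ξ (z a).1)ᵀ * M⁻¹ * gradXi ξ (z a).1).det ≠ 0) :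
    ContDiffAt ℝ 1 (fun u => multX M ξ V τ (z u) (y u)) a := by
  unfold multX
  exact (contDiffAt_mulVec (contDiffAt_inv_apply (contDiffAt_crossGram_apply hξ hz.fst hz.fst) h0)
    (contDiffAt_mulVec (contDiffAt_gradXi_transpose_apply hξ hz.fst)
      (((hy.sub hz.fst).sub ((contDiffAt_const_mulVec _ hz.snd).const_smul τ)).add
        ((contDiffAt_const_mulVec _ (contDiffAt_gradV hV hz.fst)).const_smul _)))).const_smul _

theorem contDiffAt_multP (hξ : ContDiff ℝ 2 ξ) (hV : ContDiff ℝ 2 V)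
    {z : E → (Fin d → ℝ) × (Fin d → ℝ)} {y : E → Fin d → ℝ}
    (hz : ContDiffAt ℝ 1 z a) (hy : ContDiffAt ℝ 1 y a)
    (h0 : ((gradXi ξ (z a).1)ᵀ * M⁻¹ * gradXi ξ (z a).1).det ≠ 0)
    (h1 : ((gradXi ξ (y a))ᵀ * M⁻¹ * gradXi ξ (y a)).det ≠ 0) :
    ContDiffAt ℝ 1 (fun u => multP M ξ V τ (z u) (y u)) a := by
  unfold multP
  exact (contDiffAt_mulVec (contDiffAt_inv_apply (contDiffAt_crossGram_apply hξ hy hy) h1)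
    (contDiffAt_mulVec (contDiffAt_gradXi_transpose_apply hξ hy)
      (contDiffAt_const_mulVec _ ((hz.snd.sub
        (((contDiffAt_gradV hV hz.fst).add (contDiffAt_gradV hV hy)).const_smul _)).add
        (contDiffAt_mulVec (contDiffAt_gradXi_apply hξ hz.fst)
          (contDiffAt_multX hξ hV hz hy h0)))))).neg

theorem contDiffAt_projM_apply (hξ : ContDiff ℝ 2 ξ) {x : E → Fin d → ℝ}
    (hx : ContDiffAt ℝ 1 x a) (h0 : ((gradXi ξ (x a))ᵀ * M⁻¹ * gradXi ξ (x a)).det ≠ 0)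
    (i j : Fin d) : ContDiffAt ℝ 1 (fun u => projM M ξ (x u) i j) a := by
  unfold projM
  simp only [Matrix.sub_apply]
  exact contDiffAt_const.sub (contDiffAt_mul_apply (B := fun _ => M⁻¹)
    (contDiffAt_mul_apply (contDiffAt_mul_apply (contDiffAt_gradXi_apply hξ hx)
      (contDiffAt_inv_apply (contDiffAt_crossGram_apply hξ hx hx) h0))
    (contDiffAt_gradXi_transpose_apply hξ hx)) (fun _ _ => contDiffAt_const) i j)

theorem contDiffAt_GM (hξ : ContDiff ℝ 2 ξ) (hV : ContDiff ℝ 2 V)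
    {x y : E → Fin d → ℝ} (hx : ContDiffAt ℝ 1 x a) (hy : ContDiffAt ℝ 1 y a)
    (h0 : ((gradXi ξ (x a))ᵀ * M⁻¹ * gradXi ξ (x a)).det ≠ 0) :
    ContDiffAt ℝ 1 (fun u => GM M ξ V τ (x u) (y u)) a := by
  unfold GM
  exact (contDiffAt_mulVec (contDiffAt_projM_apply hξ hx h0) (contDiffAt_const_mulVec _
    ((hy.sub hx).add ((contDiffAt_const_mulVec _ (contDiffAt_gradV hV hx)).const_smul _)))).const_smul
    _

end SchemeRegularity

/-! ### Linear algebra of one step -/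

section Algebra

variable {d k : ℕ} {M : Matrix (Fin d) (Fin d) ℝ} {ξ : (Fin d → ℝ) → (Fin k → ℝ)}
  {V : (Fin d → ℝ) → ℝ} {τ : ℝ}

theorem fderiv_eq_gradXi_transpose_mulVec (ξ : (Fin d → ℝ) → (Fin k → ℝ)) (y v : Fin d → ℝ) :
    fderiv ℝ ξ y v = (gradXi ξ y)ᵀ *ᵥ v := by
  ext j
  conv_lhs => rw [pi_eq_sum_univ' v]
  simp [gradXi, mulVec, dotProduct, mul_comm]

theorem gradXi_mulVec_injective {x : Fin d → ℝ}
    (h : ((gradXi ξ x)ᵀ * gradXi ξ x).PosDef) : Function.Injective (gradXi ξ x).mulVec := by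
  intro a b hab
  refine Matrix.mulVec_injective_of_isUnit h.isUnit ?_
  simp only [← mulVec_mulVec]
  exact congrArg _ hab

theorem gram_det_ne_zero (hM : M.PosDef) {x : Fin d → ℝ}
    (h : ((gradXi ξ x)ᵀ * gradXi ξ x).PosDef) :
    ((gradXi ξ x)ᵀ * M⁻¹ * gradXi ξ x).det ≠ 0 := by
  have := hM.inv.conjTranspose_mul_mul_same (gradXi_mulVec_injective h)
  rw [conjTranspose_eq_transpose_of_trivial] at this
  exact this.det_pos.ne'

theorem inv_mulVec_mulVec {n : Type*} [Fintype n] [DecidableEq n] {A : Matrix n n ℝ}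
    (hA : A.det ≠ 0) (v : n → ℝ) : A⁻¹ *ᵥ (A *ᵥ v) = v := by
  rw [mulVec_mulVec, Matrix.nonsing_inv_mul _ hA.isUnit, one_mulVec]

theorem mulVec_inv_mulVec {n : Type*} [Fintype n] [DecidableEq n] {A : Matrix n n ℝ}
    (hA : A.det ≠ 0) (v : n → ℝ) : A *ᵥ (A⁻¹ *ᵥ v) = v := by
  rw [mulVec_mulVec, Matrix.mul_nonsing_inv _ hA.isUnit, one_mulVec]

/-- The momentum with which one unconstrained position update of the scheme leads from `x`
to `y`. -/
noncomputable def freeMomentum (M : Matrix (Fin d) (Fin d) ℝ) (V : (Fin d → ℝ) → ℝ) (τ : ℝ)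
    (x y : Fin d → ℝ) : Fin d → ℝ :=
  (1 / τ) • (M *ᵥ (y - x + (τ ^ 2 / 2) • (M⁻¹ *ᵥ gradV V x)))

theorem rattlePos_eq_iff (hM : M.det ≠ 0) (hτ : τ ≠ 0) {z : (Fin d → ℝ) × (Fin d → ℝ)}
    {c : Fin k → ℝ} {y : Fin d → ℝ} :
    rattlePos M ξ V τ z c = y ↔ z.2 + gradXi ξ z.1 *ᵥ c = freeMomentum M V τ z.1 y := by
  have h1 : rattlePos M ξ V τ z c = z.1 - (τ ^ 2 / 2) • (M⁻¹ *ᵥ gradV V z.1) +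
      τ • (M⁻¹ *ᵥ (z.2 + gradXi ξ z.1 *ᵥ c)) := by
    rw [rattlePos, mulVec_add, smul_add]; abel
  have h2 : y = z.1 - (τ ^ 2 / 2) • (M⁻¹ *ᵥ gradV V z.1) +
      τ • (M⁻¹ *ᵥ freeMomentum M V τ z.1 y) := by
    rw [freeMomentum, mulVec_smul, inv_mulVec_mulVec hM, smul_smul, mul_one_div_cancel hτ, one_smul]
    abel
  constructor
  · intro h
    rw [h2, h1, add_right_inj] at h
    have h3 := congrArg (M *ᵥ ·) (smul_right_injective _ hτ h)
    simpa only [mulVec_inv_mulVec hM] using h3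
  · intro h
    rw [h1, h, ← h2]

theorem projM_mulVec (x v : Fin d → ℝ) : projM M ξ x *ᵥ v = v - gradXi ξ x *ᵥ
    (((gradXi ξ x)ᵀ * M⁻¹ * gradXi ξ x)⁻¹ *ᵥ ((gradXi ξ x)ᵀ *ᵥ (M⁻¹ *ᵥ v))) := by
  simp only [projM, sub_mulVec, one_mulVec, mulVec_mulVec, Matrix.mul_assoc]

theorem GM_eq_projM_freeMomentum (x y : Fin d → ℝ) :
    GM M ξ V τ x y = projM M ξ x *ᵥ freeMomentum M V τ x y := by
  rw [GM, freeMomentum, mulVec_smul]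

theorem projM_mulVec_mem_cotangentSpace {x : Fin d → ℝ}
    (h0 : ((gradXi ξ x)ᵀ * M⁻¹ * gradXi ξ x).det ≠ 0) (v : Fin d → ℝ) :
    projM M ξ x *ᵥ v ∈ cotangentSpace M ξ x := by
  change (gradXi ξ x)ᵀ *ᵥ (M⁻¹ *ᵥ (projM M ξ x *ᵥ v)) = 0
  have h := mulVec_inv_mulVec h0 ((gradXi ξ x)ᵀ *ᵥ (M⁻¹ *ᵥ v))
  rw [projM_mulVec, mulVec_sub, mulVec_sub, sub_eq_zero]
  conv_lhs => rw [← h]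
  simp only [← mulVec_mulVec]

theorem projM_mulVec_gradXi {x : Fin d → ℝ}
    (h0 : ((gradXi ξ x)ᵀ * M⁻¹ * gradXi ξ x).det ≠ 0) (c : Fin k → ℝ) :
    projM M ξ x *ᵥ (gradXi ξ x *ᵥ c) = 0 := by
  have h := inv_mulVec_mulVec h0 c
  simp only [← mulVec_mulVec] at h
  rw [projM_mulVec, h, sub_self]

theorem multX_eq (hM : M.det ≠ 0) (hτ : τ ≠ 0) {z : (Fin d → ℝ) × (Fin d → ℝ)}
    (hz : z.2 ∈ cotangentSpace M ξ z.1) (y : Fin d → ℝ) :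
    multX M ξ V τ z y = ((gradXi ξ z.1)ᵀ * M⁻¹ * gradXi ξ z.1)⁻¹ *ᵥ
      ((gradXi ξ z.1)ᵀ *ᵥ (M⁻¹ *ᵥ freeMomentum M V τ z.1 y)) := by
  have hz' : (gradXi ξ z.1)ᵀ *ᵥ (M⁻¹ *ᵥ z.2) = 0 := hz
  have h1 : y - z.1 - τ • (M⁻¹ *ᵥ z.2) + (τ ^ 2 / 2) • (M⁻¹ *ᵥ gradV V z.1) =
      τ • (M⁻¹ *ᵥ freeMomentum M V τ z.1 y) - τ • (M⁻¹ *ᵥ z.2) := by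
    rw [freeMomentum, mulVec_smul, inv_mulVec_mulVec hM, smul_smul, mul_one_div_cancel hτ, one_smul]
    abel
  rw [multX, h1, mulVec_sub, mulVec_smul, mulVec_smul, hz', smul_zero, sub_zero, mulVec_smul,
    smul_smul, one_div_mul_cancel hτ, one_smul]

/-- The position multiplier is determined by the new position. -/
theorem multX_rattlePos (hM : M.det ≠ 0) (hτ : τ ≠ 0) {z : (Fin d → ℝ) × (Fin d → ℝ)}
    (hz : z.2 ∈ cotangentSpace M ξ z.1)
    (h0 : ((gradXi ξ z.1)ᵀ * M⁻¹ * gradXi ξ z.1).det ≠ 0) (c : Fin k → ℝ) :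
    multX M ξ V τ z (rattlePos M ξ V τ z c) = c := by
  have hz' : (gradXi ξ z.1)ᵀ *ᵥ (M⁻¹ *ᵥ z.2) = 0 := hz
  have h := inv_mulVec_mulVec h0 c
  simp only [← mulVec_mulVec] at h
  rw [multX_eq hM hτ hz, ← (rattlePos_eq_iff hM hτ).1 rfl, mulVec_add, mulVec_add, hz', zero_add, h]

/-- The step from `z` can reach `y` exactly if `G_{M,x}(y) = p`. -/
theorem rattlePos_multX_eq_iff (hM : M.det ≠ 0) (hτ : τ ≠ 0) {z : (Fin d → ℝ) × (Fin d → ℝ)}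
    (hz : z.2 ∈ cotangentSpace M ξ z.1) {y : Fin d → ℝ} :
    rattlePos M ξ V τ z (multX M ξ V τ z y) = y ↔ GM M ξ V τ z.1 y = z.2 := by
  rw [rattlePos_eq_iff hM hτ, multX_eq hM hτ hz, GM_eq_projM_freeMomentum, projM_mulVec,
    sub_eq_iff_eq_add, eq_comm]

/-- The momentum constraint at `y` has exactly one multiplier. -/
theorem neg_add_gradXi_mem_cotangentSpace_iff {y : Fin d → ℝ}
    (h0 : ((gradXi ξ y)ᵀ * M⁻¹ * gradXi ξ y).det ≠ 0) {u : Fin d → ℝ} {c : Fin k → ℝ} :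
    -(u + gradXi ξ y *ᵥ c) ∈ cotangentSpace M ξ y ↔
      c = -(((gradXi ξ y)ᵀ * M⁻¹ * gradXi ξ y)⁻¹ *ᵥ ((gradXi ξ y)ᵀ *ᵥ (M⁻¹ *ᵥ u))) := by
  have h1 : -(u + gradXi ξ y *ᵥ c) ∈ cotangentSpace M ξ y ↔
      (gradXi ξ y)ᵀ *ᵥ (M⁻¹ *ᵥ u) + ((gradXi ξ y)ᵀ * M⁻¹ * gradXi ξ y) *ᵥ c = 0 := by
    change (gradXi ξ y)ᵀ *ᵥ (M⁻¹ *ᵥ -(u + gradXi ξ y *ᵥ c)) = 0 ↔ _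
    simp only [mulVec_neg, mulVec_add, ← mulVec_mulVec, neg_eq_zero]
  rw [h1]
  constructor
  · intro h
    have := inv_mulVec_mulVec h0 c
    rw [← this, eq_neg_of_add_eq_zero_right h, mulVec_neg]
  · rintro rfl
    rw [mulVec_neg, mulVec_inv_mulVec h0, add_neg_cancel]

end Algebra

/-! ### Outcomes and multipliers, and the degenerate set -/

section Outcomes

variable {d k : ℕ} {M : Matrix (Fin d) (Fin d) ℝ} {ξ : (Fin d → ℝ) → (Fin k → ℝ)}
  {V : (Fin d → ℝ) → ℝ} {τ : ℝ}

/-- The position multipliers `c` for which the scheme, started at `z`, returns to the level set. -/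
def multiplierSet (M : Matrix (Fin d) (Fin d) ℝ) (ξ : (Fin d → ℝ) → (Fin k → ℝ))
    (V : (Fin d → ℝ) → ℝ) (τ : ℝ) (z : (Fin d → ℝ) × (Fin d → ℝ)) : Set (Fin k → ℝ) :=
  {c | ξ (rattlePos M ξ V τ z c) = 0}

/-- The outcome of the scheme with position multiplier `c`; the momentum multiplier is the one that
projects the momentum onto the cotangent space. -/
noncomputable def outcomeOf (M : Matrix (Fin d) (Fin d) ℝ) (ξ : (Fin d → ℝ) → (Fin k → ℝ))
    (V : (Fin d → ℝ) → ℝ) (τ : ℝ) (z : (Fin d → ℝ) × (Fin d → ℝ)) (c : Fin k → ℝ) :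
    (Fin d → ℝ) × (Fin d → ℝ) :=
  rattleMap M ξ V τ z c (multP M ξ V τ z (rattlePos M ξ V τ z c))

/-- Together with `outcomeOf_injective`, this identifies the outcomes with the solutions of the `k`
equations defining `multiplierSet`. -/
theorem outcomes_eq_image (hM : M.det ≠ 0) (hτ : τ ≠ 0)
    (hgram : ∀ x ∈ levelSet ξ, ((gradXi ξ x)ᵀ * M⁻¹ * gradXi ξ x).det ≠ 0)
    {z : (Fin d → ℝ) × (Fin d → ℝ)} (hz : z ∈ cotangentBundle M ξ) :
    outcomes M ξ V τ z = outcomeOf M ξ V τ z '' multiplierSet M ξ V τ z := by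
  have key : ∀ c cp, ξ (rattlePos M ξ V τ z c) = 0 → ((rattleMap M ξ V τ z c cp).2 ∈
      cotangentSpace M ξ (rattlePos M ξ V τ z c) ↔
        cp = multP M ξ V τ z (rattlePos M ξ V τ z c)) := by
    intro c cp hc
    refine (neg_add_gradXi_mem_cotangentSpace_iff (hgram _ hc)).trans ?_
    rw [multP, multX_rattlePos hM hτ hz.2 (hgram _ hz.1)]
  ext z'
  constructor
  · rintro ⟨⟨h1, h2⟩, c, cp, rfl⟩
    exact ⟨c, h1, by rw [outcomeOf, (key c cp h1).1 h2]⟩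
  · rintro ⟨c, hc, rfl⟩
    exact ⟨⟨hc, (key c _ hc).2 rfl⟩, c, _, rfl⟩

theorem outcomeOf_injective (hM : M.det ≠ 0) (hτ : τ ≠ 0)
    (hgram : ∀ x ∈ levelSet ξ, ((gradXi ξ x)ᵀ * M⁻¹ * gradXi ξ x).det ≠ 0)
    {z : (Fin d → ℝ) × (Fin d → ℝ)} (hz : z ∈ cotangentBundle M ξ) :
    Function.Injective (outcomeOf M ξ V τ z) := by
  intro c c' h
  have h1 : rattlePos M ξ V τ z c = rattlePos M ξ V τ z c' := congrArg Prod.fst h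
  rw [← multX_rattlePos hM hτ hz.2 (hgram _ hz.1) c (V := V), h1,
    multX_rattlePos hM hτ hz.2 (hgram _ hz.1)]

theorem GM_rattlePos (hM : M.det ≠ 0) (hτ : τ ≠ 0)
    (hgram : ∀ x ∈ levelSet ξ, ((gradXi ξ x)ᵀ * M⁻¹ * gradXi ξ x).det ≠ 0)
    {z : (Fin d → ℝ) × (Fin d → ℝ)} (hz : z ∈ cotangentBundle M ξ) (c : Fin k → ℝ) :
    GM M ξ V τ z.1 (rattlePos M ξ V τ z c) = z.2 := by
  rw [← rattlePos_multX_eq_iff hM hτ hz.2, multX_rattlePos hM hτ hz.2 (hgram _ hz.1)]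

theorem mem_badSet_iff (hM : M.det ≠ 0) (hτ : τ ≠ 0)
    (hgram : ∀ x ∈ levelSet ξ, ((gradXi ξ x)ᵀ * M⁻¹ * gradXi ξ x).det ≠ 0)
    {z : (Fin d → ℝ) × (Fin d → ℝ)} (hz : z ∈ cotangentBundle M ξ) :
    z ∈ badSet M ξ V τ ↔ ∃ c ∈ multiplierSet M ξ V τ z,
      ((gradXi ξ (rattlePos M ξ V τ z c))ᵀ * M⁻¹ * gradXi ξ z.1).det = 0 := by
  constructor
  · rintro ⟨-, y, ⟨hy, hdet⟩, hGy⟩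
    have h := (rattlePos_multX_eq_iff hM hτ hz.2).2 hGy
    refine ⟨multX M ξ V τ z y, ?_, by rwa [h]⟩
    change ξ _ = 0
    rw [h]
    exact hy
  · rintro ⟨c, hc, hdet⟩
    exact ⟨hz, _, ⟨hc, hdet⟩, GM_rattlePos hM hτ hgram hz c⟩

theorem badSet_eq_outcomes (hM : M.det ≠ 0) (hτ : τ ≠ 0)
    (hgram : ∀ x ∈ levelSet ξ, ((gradXi ξ x)ᵀ * M⁻¹ * gradXi ξ x).det ≠ 0) :
    badSet M ξ V τ = {z | z ∈ cotangentBundle M ξ ∧ ∃ z' ∈ outcomes M ξ V τ z,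
      ((gradXi ξ z'.1)ᵀ * M⁻¹ * gradXi ξ z.1).det = 0} := by
  ext z
  by_cases hz : z ∈ cotangentBundle M ξ
  · rw [mem_badSet_iff hM hτ hgram hz]
    change _ ↔ z ∈ cotangentBundle M ξ ∧ ∃ z' ∈ outcomes M ξ V τ z,
      ((gradXi ξ z'.1)ᵀ * M⁻¹ * gradXi ξ z.1).det = 0
    rw [outcomes_eq_image hM hτ hgram hz, exists_mem_image]
    exact (and_iff_right hz).symm
  · exact ⟨fun h => absurd h.1 hz, fun h => absurd h.1 hz⟩

/-- The degenerate set is the image of a compact subset of `Σ × Σ` under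
`(x, y) ↦ (x, G_{M,x}(y))`. -/
theorem isCompact_badSet (hξ : ContDiff ℝ 2 ξ) (hV : ContDiff ℝ 2 V)
    (hcompact : IsCompact (levelSet ξ))
    (hgram : ∀ x ∈ levelSet ξ, ((gradXi ξ x)ᵀ * M⁻¹ * gradXi ξ x).det ≠ 0) :
    IsCompact (badSet M ξ V τ) := by
  have hgrad : Continuous (gradXi ξ) := continuous_gradXi (hξ.of_le (by norm_num))
  have hclosed : IsClosed {u : (Fin d → ℝ) × (Fin d → ℝ) |
      ((gradXi ξ u.2)ᵀ * M⁻¹ * gradXi ξ u.1).det = 0} := by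
    refine isClosed_eq (Continuous.matrix_det ?_) continuous_const
    exact ((hgrad.comp continuous_snd).matrix_transpose.matrix_mul
      continuous_const).matrix_mul (hgrad.comp continuous_fst)
  have hK := (hcompact.prod hcompact).inter_right hclosed
  have hcont : ContinuousOn (fun u : (Fin d → ℝ) × (Fin d → ℝ) => (u.1, GM M ξ V τ u.1 u.2))
      (levelSet ξ ×ˢ levelSet ξ ∩ {u | ((gradXi ξ u.2)ᵀ * M⁻¹ * gradXi ξ u.1).det = 0}) := by
    intro u hu
    exact (continuousAt_fst.prodMk (contDiffAt_GM hξ hV contDiffAt_fst contDiffAt_snd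
      (hgram _ hu.1.1)).continuousAt).continuousWithinAt
  convert hK.image_of_continuousOn hcont using 1
  ext z
  constructor
  · rintro ⟨hz, y, ⟨hy, hdet⟩, hGy⟩
    exact ⟨(z.1, y), ⟨⟨hz.1, hy⟩, hdet⟩, Prod.ext rfl hGy⟩
  · rintro ⟨⟨x, y⟩, ⟨⟨hx, hy⟩, hdet⟩, rfl⟩
    refine ⟨⟨hx, ?_⟩, y, ⟨hy, hdet⟩, rfl⟩
    change GM M ξ V τ x y ∈ _
    rw [GM_eq_projM_freeMomentum]
    exact projM_mulVec_mem_cotangentSpace (hgram x hx) _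

end Outcomes

/-! ### The degenerate set is null -/

section NullSet

open Module

variable {d k : ℕ} {M : Matrix (Fin d) (Fin d) ℝ} {ξ : (Fin d → ℝ) → (Fin k → ℝ)}
  {V : (Fin d → ℝ) → ℝ} {τ : ℝ}

/-- Surface measures are absolutely continuous with respect to the Hausdorff measure of the sup norm,
since linear isomorphisms are bi-Lipschitz. -/
theorem surfaceMeasure_eq_zero_of_hausdorffMeasure_eq_zero {A : Matrix (Fin d) (Fin d) ℝ}
    (hA : A.PosDef) {m : ℕ} {S B : Set (Fin d → ℝ)} (hB : MeasurableSet B)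
    (h0 : Measure.hausdorffMeasure (m : ℝ) B = 0) : surfaceMeasure A m S B = 0 := by
  have hu : IsUnit (CFC.sqrt A)⁻¹ := by
    have h1 : (CFC.sqrt A).det ≠ 0 := by
      rw [hA.posSemidef.det_sqrt, RCLike.sqrt_of_nonneg hA.det_pos.le]
      exact (Real.sqrt_pos.2 hA.det_pos).ne'
    rw [Matrix.isUnit_nonsing_inv_iff, Matrix.isUnit_iff_isUnit_det]
    exact h1.isUnit
  let f : EuclideanSpace ℝ (Fin d) →ₗ[ℝ] (Fin d → ℝ) :=
    ((CFC.sqrt A)⁻¹).mulVecLin ∘ₗ (WithLp.linearEquiv 2 ℝ (Fin d → ℝ)).toLinearMap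
  have hinj : Function.Injective f := (Matrix.mulVec_injective_of_isUnit hu).comp
    (WithLp.linearEquiv 2 ℝ (Fin d → ℝ)).injective
  have hf : Continuous f := f.continuous_of_finiteDimensional
  obtain ⟨K, -, hK⟩ := f.exists_antilipschitzWith (LinearMap.ker_eq_bot.2 hinj)
  refine nonpos_iff_eq_zero.1 ((Measure.restrict_apply_le _ _).trans ?_)
  change Measure.map f _ B ≤ 0
  rw [Measure.map_apply hf.measurable hB, Measure.euclideanHausdorffMeasure_def,
    Measure.smul_apply]
  have h1 := hK.hausdorffMeasure_preimage_le (Nat.cast_nonneg m) B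
  rw [h0, mul_zero, nonpos_iff_eq_zero] at h1
  rw [h1, smul_zero]

/-- By Sard's theorem, the critical values of `G_{M,x}` are a null set of dimension `d - k`. -/
theorem hausdorffMeasure_GM_image_critSet_eq_zero (hξ : ContDiff ℝ 1 ξ)
    (hcompact : IsCompact (levelSet ξ))
    (hrank : ∀ x ∈ levelSet ξ, ((gradXi ξ x)ᵀ * gradXi ξ x).PosDef)
    (hM : M.PosDef) {x : Fin d → ℝ} (hx : x ∈ levelSet ξ) :
    Measure.hausdorffMeasure ((d - k : ℕ) : ℝ) (GM M ξ V τ x '' critSet M ξ x) = 0 := by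
  have hdetM := hM.det_pos.ne'
  have hg0 := gram_det_ne_zero hM (hrank x hx)
  let W : Submodule ℝ (Fin d → ℝ) := LinearMap.ker ((gradXi ξ x)ᵀ * M⁻¹).mulVecLin
  have hW : ∀ v, v ∈ W ↔ v ∈ cotangentSpace M ξ x := fun v => by
    change ((gradXi ξ x)ᵀ * M⁻¹) *ᵥ v = 0 ↔ (gradXi ξ x)ᵀ *ᵥ (M⁻¹ *ᵥ v) = 0
    rw [mulVec_mulVec]
  have hdim : finrank ℝ W + k = d := by
    have hsurj : Function.Surjective ((gradXi ξ x)ᵀ * M⁻¹).mulVecLin := fun c => by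
      refine ⟨gradXi ξ x *ᵥ (((gradXi ξ x)ᵀ * M⁻¹ * gradXi ξ x)⁻¹ *ᵥ c), ?_⟩
      rw [mulVecLin_apply, mulVec_mulVec, mulVec_inv_mulVec hg0]
    have h := ((gradXi ξ x)ᵀ * M⁻¹).mulVecLin.finrank_range_add_finrank_ker
    rw [LinearMap.range_eq_top.2 hsurj] at h
    simp only [finrank_top, Module.finrank_fintype_fun_eq_card, Fintype.card_fin] at h
    change k + finrank ℝ W = d at h
    omega
  let P : (Fin d → ℝ) →L[ℝ] W := LinearMap.toContinuousLinearMap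
    ((projM M ξ x).mulVecLin.codRestrict W fun v =>
      (hW _).2 (projM_mulVec_mem_cotangentSpace hg0 v))
  have hP : ∀ v, (P v : Fin d → ℝ) = projM M ξ x *ᵥ v := fun v => rfl
  let T : (Fin d → ℝ) →L[ℝ] (Fin d → ℝ) := LinearMap.toContinuousLinearMap M.mulVecLin
  let g : (Fin d → ℝ) → W := fun y => P (freeMomentum M V τ x y)
  have hg : ∀ y, HasFDerivAt g (P.comp ((1 / τ) • T)) y := fun y =>
    P.hasFDerivAt.comp y (((T.hasFDerivAt.comp y
      (((hasFDerivAt_id y).sub_const x).add_const _))).const_smul (1 / τ))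
  -- `G_{M,x}` maps `Σ` into `W = T*_xΣ`, which has the same dimension.
  have hsard := hausdorffMeasure_image_critical_levelSet_eq_zero (g := g) (c := 0) hξ hcompact
    (fun y hy c => by
      refine ⟨gradXi ξ y *ᵥ (((gradXi ξ y)ᵀ * gradXi ξ y)⁻¹ *ᵥ c), ?_⟩
      rw [fderiv_eq_gradXi_transpose_mulVec, mulVec_mulVec,
        mulVec_inv_mulVec (hrank y hy).det_pos.ne'])
    (fun y => (hg y).differentiableAt) (by simpa using hdim)
  have hsub : GM M ξ V τ x '' critSet M ξ x ⊆ Subtype.val '' (g '' {y | ξ y = 0 ∧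
      ∃ v ≠ 0, fderiv ℝ ξ y v = 0 ∧ fderiv ℝ g y v = 0}) := by
    rintro _ ⟨y, ⟨hy, hdet⟩, rfl⟩
    obtain ⟨c, hc0, hc⟩ := Matrix.exists_mulVec_eq_zero_iff.2 hdet
    -- A kernel vector `c` of the cross Gram matrix gives the tangent vector `M⁻¹ ∇ξ(x) c` of `Σ` at
    -- `y`, which `P_M(x) M` kills.
    refine ⟨g y, ⟨y, ⟨hy, M⁻¹ *ᵥ (gradXi ξ x *ᵥ c), ?_, ?_, ?_⟩, rfl⟩, ?_⟩
    · intro h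
      refine hc0 (gradXi_mulVec_injective (hrank x hx) ?_)
      rw [← mulVec_inv_mulVec hdetM (gradXi ξ x *ᵥ c), h, mulVec_zero, mulVec_zero]
    · rw [fderiv_eq_gradXi_transpose_mulVec]
      simpa only [mulVec_mulVec, Matrix.mul_assoc] using hc
    · rw [(hg y).fderiv]
      have : T (M⁻¹ *ᵥ (gradXi ξ x *ᵥ c)) = gradXi ξ x *ᵥ c := mulVec_inv_mulVec hdetM _
      ext1
      change projM M ξ x *ᵥ ((1 / τ) • T (M⁻¹ *ᵥ (gradXi ξ x *ᵥ c))) = 0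
      rw [this, mulVec_smul, projM_mulVec_gradXi hg0, smul_zero]
    · rw [GM_eq_projM_freeMomentum, ← hP]
  refine measure_mono_null hsub ?_
  rw [isometry_subtype_coe.hausdorffMeasure_image (Or.inl (Nat.cast_nonneg _))]
  rwa [show d - k = finrank ℝ W by omega]

theorem liouvilleMeasure_badSet (hξ : ContDiff ℝ 2 ξ) (hV : ContDiff ℝ 2 V)
    (hcompact : IsCompact (levelSet ξ))
    (hrank : ∀ x ∈ levelSet ξ, ((gradXi ξ x)ᵀ * gradXi ξ x).PosDef) (hM : M.PosDef) :
    liouvilleMeasure M ξ (badSet M ξ V τ) = 0 := by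
  have hmeas : MeasurableSet (badSet M ξ V τ) := (isCompact_badSet hξ hV hcompact
    fun x hx => gram_det_ne_zero hM (hrank x hx)).isClosed.measurableSet
  have hξ1 : ContDiff ℝ 1 ξ := hξ.of_le (by norm_num)
  rw [liouvilleMeasure_apply hξ1 hrank hM hmeas, surfaceMeasure]
  refine (lintegral_congr_ae ?_).trans lintegral_zero
  filter_upwards [ae_restrict_mem hcompact.isClosed.measurableSet] with x hx
  refine surfaceMeasure_eq_zero_of_hausdorffMeasure_eq_zero hM.inv
    (measurable_prodMk_left hmeas) (measure_mono_null ?_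
      (hausdorffMeasure_GM_image_critSet_eq_zero hξ1 hcompact hrank hM hx (V := V) (τ := τ)))
  exact fun p hp => And.right hp

end NullSet

/-! ### Local branches of multipliers and outcomes -/

section Branches

open Filter Topology

variable {d k : ℕ} {M : Matrix (Fin d) (Fin d) ℝ} {ξ : (Fin d → ℝ) → (Fin k → ℝ)}
  {V : (Fin d → ℝ) → ℝ} {τ : ℝ}

/-- The partial derivative of the constraint `ξ ∘ rattlePos` in the multiplier is
`τ ∇ξ(y)ᵀ M⁻¹ ∇ξ(x)`, where `y` is the new position. -/
theorem hasFDerivAt_constraint (hξ : ContDiff ℝ 1 ξ) (z : (Fin d → ℝ) × (Fin d → ℝ))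
    (c : Fin k → ℝ) :
    HasFDerivAt (fun c => ξ (rattlePos M ξ V τ z c)) (LinearMap.toContinuousLinearMap
      (τ • ((gradXi ξ (rattlePos M ξ V τ z c))ᵀ * M⁻¹ * gradXi ξ z.1)).mulVecLin) c := by
  let T : (Fin k → ℝ) →L[ℝ] (Fin d → ℝ) :=
    LinearMap.toContinuousLinearMap (M⁻¹ * gradXi ξ z.1).mulVecLin
  have hpos : HasFDerivAt (rattlePos M ξ V τ z) (τ • T) c := by
    have h : rattlePos M ξ V τ z = fun c =>
        z.1 + τ • (M⁻¹ *ᵥ z.2) - (τ ^ 2 / 2) • (M⁻¹ *ᵥ gradV V z.1) + τ • T c := by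
      ext1 c
      rw [rattlePos, mulVec_mulVec]
      rfl
    rw [h]
    exact (T.hasFDerivAt.const_smul τ).const_add _
  refine ((hξ.differentiable one_ne_zero _).hasFDerivAt.comp c hpos).congr_fderiv ?_
  ext1 v
  change fderiv ℝ ξ _ (τ • ((M⁻¹ * gradXi ξ z.1) *ᵥ v)) =
    (τ • ((gradXi ξ (rattlePos M ξ V τ z c))ᵀ * M⁻¹ * gradXi ξ z.1)) *ᵥ v
  rw [fderiv_eq_gradXi_transpose_mulVec, mulVec_smul, mulVec_mulVec, smul_mulVec, Matrix.mul_assoc]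

/-- At a nondegenerate multiplier, the multipliers form locally the graph of a `C¹` function
of the state. -/
theorem exists_multiplier_branch (hξ : ContDiff ℝ 2 ξ) (hV : ContDiff ℝ 2 V) (hτ : τ ≠ 0)
    {z : (Fin d → ℝ) × (Fin d → ℝ)} {c : Fin k → ℝ} (hc : c ∈ multiplierSet M ξ V τ z)
    (h0 : ((gradXi ξ (rattlePos M ξ V τ z c))ᵀ * M⁻¹ * gradXi ξ z.1).det ≠ 0) :
    ∃ l : (Fin d → ℝ) × (Fin d → ℝ) → (Fin k → ℝ), l z = c ∧ ContDiffAt ℝ 1 l z ∧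
      ∀ᶠ v in 𝓝 (z, c), v.2 ∈ multiplierSet M ξ V τ v.1 ↔ l v.1 = v.2 := by
  have hξ1 : ContDiff ℝ 1 ξ := hξ.of_le (by norm_num)
  let Ψ : ((Fin d → ℝ) × (Fin d → ℝ)) × (Fin k → ℝ) → (Fin k → ℝ) :=
    fun v => ξ (rattlePos M ξ V τ v.1 v.2)
  have hΨ : ContDiffAt ℝ 1 Ψ (z, c) := hξ1.contDiffAt.comp (z, c)
    (contDiffAt_rattlePos hξ hV contDiffAt_fst contDiffAt_snd)
  have hpart : fderiv ℝ Ψ (z, c) ∘L .inr ℝ _ _ = LinearMap.toContinuousLinearMap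
      (τ • ((gradXi ξ (rattlePos M ξ V τ z c))ᵀ * M⁻¹ * gradXi ξ z.1)).mulVecLin :=
    ((hΨ.differentiableAt one_ne_zero).hasFDerivAt.comp c
      (hasFDerivAt_prodMk_right z c)).unique (hasFDerivAt_constraint hξ1 z c)
  have hinv : (fderiv ℝ Ψ (z, c) ∘L .inr ℝ _ _).IsInvertible := by
    have hinj : Function.Injective
        (τ • ((gradXi ξ (rattlePos M ξ V τ z c))ᵀ * M⁻¹ * gradXi ξ z.1)).mulVecLin := by
      refine Matrix.mulVec_injective_of_isUnit ((Matrix.isUnit_iff_isUnit_det _).2 ?_)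
      rw [Matrix.det_smul]
      exact (mul_ne_zero (pow_ne_zero _ hτ) h0).isUnit
    refine ⟨(LinearEquiv.ofInjectiveEndo _ hinj).toContinuousLinearEquiv, ?_⟩
    rw [hpart]
    rfl
  have hc' : Ψ (z, c) = 0 := hc
  refine ⟨hΨ.implicitFunction one_ne_zero hinv, hΨ.implicitFunction_apply_self _ _,
    hΨ.contDiffAt_implicitFunction _ _, ?_⟩
  have h := hΨ.eventually_apply_eq_iff_implicitFunction one_ne_zero hinv
  rw [hc'] at h
  exact h

theorem det_ne_zero_of_notMem_badSet (hM : M.det ≠ 0) (hτ : τ ≠ 0)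
    (hgram : ∀ x ∈ levelSet ξ, ((gradXi ξ x)ᵀ * M⁻¹ * gradXi ξ x).det ≠ 0)
    {z : (Fin d → ℝ) × (Fin d → ℝ)} (hz : z ∈ cotangentBundle M ξ \ badSet M ξ V τ)
    {c : Fin k → ℝ} (hc : c ∈ multiplierSet M ξ V τ z) :
    ((gradXi ξ (rattlePos M ξ V τ z c))ᵀ * M⁻¹ * gradXi ξ z.1).det ≠ 0 :=
  fun h => hz.2 ((mem_badSet_iff hM hτ hgram hz.1).2 ⟨c, hc, h⟩)

/-- Away from the degenerate set the multipliers form a compact set of isolated points. -/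
theorem finite_multiplierSet (hξ : ContDiff ℝ 2 ξ) (hV : ContDiff ℝ 2 V)
    (hcompact : IsCompact (levelSet ξ)) (hM : M.det ≠ 0) (hτ : τ ≠ 0)
    (hgram : ∀ x ∈ levelSet ξ, ((gradXi ξ x)ᵀ * M⁻¹ * gradXi ξ x).det ≠ 0)
    {z : (Fin d → ℝ) × (Fin d → ℝ)} (hz : z ∈ cotangentBundle M ξ \ badSet M ξ V τ) :
    (multiplierSet M ξ V τ z).Finite := by
  have hclosed : IsClosed (multiplierSet M ξ V τ z) := by
    refine isClosed_eq (hξ.continuous.comp ?_) continuous_const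
    exact continuous_iff_continuousAt.2 fun c =>
      (contDiffAt_rattlePos hξ hV contDiffAt_const contDiffAt_id).continuousAt
  have hcont : Continuous (multX M ξ V τ z) := continuous_iff_continuousAt.2 fun c =>
    (contDiffAt_multX hξ hV contDiffAt_const contDiffAt_id (hgram _ hz.1.1)).continuousAt
  have hsub : multiplierSet M ξ V τ z ⊆ multX M ξ V τ z '' levelSet ξ := fun c hc =>
    ⟨_, hc, multX_rattlePos hM hτ hz.1.2 (hgram _ hz.1.1) c⟩
  have hK : IsCompact (multiplierSet M ξ V τ z) :=
    (hcompact.image hcont).of_isClosed_subset hclosed hsub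
  have key := hK.induction_on (p := fun s => (s ∩ multiplierSet M ξ V τ z).Finite)
    (by simp) (fun s t hst ht => ht.subset (inter_subset_inter_left _ hst))
    (fun s t hs ht => by rw [union_inter_distrib_right]; exact hs.union ht)
    (fun c hc => by
      obtain ⟨l, hl, -, hev⟩ := exists_multiplier_branch hξ hV hτ hc
        (det_ne_zero_of_notMem_badSet hM hτ hgram hz hc)
      have hev' : ∀ᶠ c' in 𝓝 c, c' ∈ multiplierSet M ξ V τ z ↔ l z = c' :=
        (Continuous.prodMk_right z).continuousAt.eventually hev
      refine ⟨_, mem_nhdsWithin_of_mem_nhds hev', (finite_singleton c).subset ?_⟩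
      rintro c' ⟨h1, h2⟩
      exact (((show _ ↔ _ from h1).1 h2).symm.trans hl))
  simpa using key

/-- Locally in `T*Σ`, outside the degenerate set, the multipliers are the values of finitely many
`C¹` branches with distinct values. That no further multiplier appears near the given
state follows from compactness of the level set. -/
theorem exists_multiplier_branches (hξ : ContDiff ℝ 2 ξ) (hV : ContDiff ℝ 2 V)
    (hcompact : IsCompact (levelSet ξ)) (hM : M.det ≠ 0) (hτ : τ ≠ 0)
    (hgram : ∀ x ∈ levelSet ξ, ((gradXi ξ x)ᵀ * M⁻¹ * gradXi ξ x).det ≠ 0)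
    {z : (Fin d → ℝ) × (Fin d → ℝ)} (hz : z ∈ cotangentBundle M ξ \ badSet M ξ V τ)
    {n : ℕ} {c : Fin n → Fin k → ℝ} (hinj : Function.Injective c)
    (hc : multiplierSet M ξ V τ z = range c) :
    ∃ l : Fin n → (Fin d → ℝ) × (Fin d → ℝ) → (Fin k → ℝ),
      (∀ i, l i z = c i ∧ ContDiffAt ℝ 1 (l i) z) ∧
      ∀ᶠ z' in 𝓝 z, z' ∈ cotangentBundle M ξ → Function.Injective (fun i => l i z') ∧
        multiplierSet M ξ V τ z' = range fun i => l i z' := by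
  have hmem : ∀ i, c i ∈ multiplierSet M ξ V τ z := fun i => hc ▸ mem_range_self i
  choose l hlz hlC hlev using fun i => exists_multiplier_branch hξ hV hτ (hmem i)
    (det_ne_zero_of_notMem_badSet hM hτ hgram hz (hmem i))
  refine ⟨l, fun i => ⟨hlz i, hlC i⟩, ?_⟩
  have hdist : ∀ᶠ z' in 𝓝 z, ∀ i j, i ≠ j → l i z' ≠ l j z' := by
    simp only [eventually_all]
    intro i j hij
    refine ((hlC i).continuousAt.ne_iff_eventually_ne (hlC j).continuousAt).1 ?_
    rw [hlz, hlz]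
    exact hinj.ne hij
  have hsol : ∀ᶠ z' in 𝓝 z, ∀ i, l i z' ∈ multiplierSet M ξ V τ z' := by
    refine eventually_all.2 fun i => ?_
    have ht : Tendsto (fun z' => (z', l i z')) (𝓝 z) (𝓝 (z, c i)) := by
      rw [← hlz i]
      exact (continuousAt_id.prodMk (hlC i).continuousAt)
    filter_upwards [ht.eventually (hlev i)] with z' h
    exact h.2 rfl
  -- Every multiplier is `multX` of a point `y` of the compact level set, so a statement about all
  -- multipliers near `z` can be checked locally around each `(z, y)`.
  have htube : ∀ᶠ z' in 𝓝 z, ∀ y ∈ levelSet ξ, ξ y = 0 →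
      rattlePos M ξ V τ z' (multX M ξ V τ z' y) = y → ∃ i, l i z' = multX M ξ V τ z' y := by
    refine hcompact.eventually_forall_of_forall_eventually fun y hy => ?_
    have hX : ContDiffAt ℝ 1 (fun u : ((Fin d → ℝ) × (Fin d → ℝ)) × (Fin d → ℝ) =>
        multX M ξ V τ u.1 u.2) (z, y) :=
      contDiffAt_multX hξ hV contDiffAt_fst contDiffAt_snd (hgram _ hz.1.1)
    by_cases hzy : rattlePos M ξ V τ z (multX M ξ V τ z y) = y
    · have : multX M ξ V τ z y ∈ range c := by
        rw [← hc]
        change ξ _ = 0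
        rw [hzy]
        exact hy
      obtain ⟨i, hi⟩ := this
      have ht : Tendsto (fun u : ((Fin d → ℝ) × (Fin d → ℝ)) × (Fin d → ℝ) =>
          (u.1, multX M ξ V τ u.1 u.2)) (𝓝 (z, y)) (𝓝 (z, c i)) := by
        rw [hi]
        exact continuousAt_fst.prodMk hX.continuousAt
      filter_upwards [ht.eventually (hlev i)] with u hu hy' hpos
      exact ⟨i, hu.1 (by change ξ _ = 0; rw [hpos, hy'])⟩
    · have hne := ((contDiffAt_rattlePos (M := M) (τ := τ) hξ hV contDiffAt_fst
        hX).continuousAt.ne_iff_eventually_ne continuousAt_snd).1 hzy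
      filter_upwards [hne] with u hu _ hpos
      exact absurd hpos hu
  filter_upwards [hdist, hsol, htube] with z' h1 h2 h3 hz'
  refine ⟨fun i j hij => by_contra fun h => h1 i j h hij, Subset.antisymm (fun c' hc' => ?_) ?_⟩
  · have hX := multX_rattlePos hM hτ hz'.2 (hgram _ hz'.1) c' (V := V)
    obtain ⟨i, hi⟩ := h3 _ hc' hc' (by rw [hX])
    exact ⟨i, hi.trans hX⟩
  · rintro _ ⟨i, rfl⟩
    exact h2 i

theorem finite_outcomes (hξ : ContDiff ℝ 2 ξ) (hV : ContDiff ℝ 2 V)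
    (hcompact : IsCompact (levelSet ξ)) (hM : M.det ≠ 0) (hτ : τ ≠ 0)
    (hgram : ∀ x ∈ levelSet ξ, ((gradXi ξ x)ᵀ * M⁻¹ * gradXi ξ x).det ≠ 0)
    {z : (Fin d → ℝ) × (Fin d → ℝ)} (hz : z ∈ cotangentBundle M ξ \ badSet M ξ V τ) :
    (outcomes M ξ V τ z).Finite := by
  rw [outcomes_eq_image hM hτ hgram hz.1]
  exact (finite_multiplierSet hξ hV hcompact hM hτ hgram hz).image _

/-- The number of outcomes is locally constant, the case of no outcomes included. -/
theorem eventually_encard_outcomes_eq (hξ : ContDiff ℝ 2 ξ) (hV : ContDiff ℝ 2 V)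
    (hcompact : IsCompact (levelSet ξ)) (hM : M.det ≠ 0) (hτ : τ ≠ 0)
    (hgram : ∀ x ∈ levelSet ξ, ((gradXi ξ x)ᵀ * M⁻¹ * gradXi ξ x).det ≠ 0)
    {z : (Fin d → ℝ) × (Fin d → ℝ)} (hz : z ∈ cotangentBundle M ξ \ badSet M ξ V τ) :
    ∀ᶠ z' in 𝓝 z, z' ∈ cotangentBundle M ξ →
      (outcomes M ξ V τ z').encard = (outcomes M ξ V τ z).encard := by
  have hfin := finite_multiplierSet hξ hV hcompact hM hτ hgram hz
  have hcard : ∀ z' ∈ cotangentBundle M ξ,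
      (outcomes M ξ V τ z').encard = (multiplierSet M ξ V τ z').encard := fun z' hz' => by
    rw [outcomes_eq_image hM hτ hgram hz', (outcomeOf_injective hM hτ hgram hz').encard_image]
  obtain ⟨n, c, hc, hinj⟩ := hfin.fin_param
  obtain ⟨l, -, hev⟩ := exists_multiplier_branches hξ hV hcompact hM hτ hgram hz hc hinj.symm
  have hz' := hev.self_of_nhds hz.1
  filter_upwards [hev] with z' h hz''
  rw [hcard _ hz'', hcard _ hz.1, (h hz'').2, hz'.2, ← image_univ, ← image_univ,
    (h hz'').1.encard_image, hz'.1.encard_image]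

theorem disjoint_branchSet_badSet (hM : M.det ≠ 0) (hτ : τ ≠ 0)
    (hgram : ∀ x ∈ levelSet ξ, ((gradXi ξ x)ᵀ * M⁻¹ * gradXi ξ x).det ≠ 0) (i : ℕ) :
    Disjoint (branchSet M ξ V τ i) (badSet M ξ V τ) := by
  refine Set.disjoint_left.2 fun z hz hbad => ?_
  cases i with
  | zero =>
    rw [badSet_eq_outcomes hM hτ hgram] at hbad
    obtain ⟨-, z', hz', -⟩ := hbad
    rw [Set.encard_eq_zero.1 hz.2] at hz'
    exact hz'
  | succ i => exact hz.1.2 hbad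

/-- A uniform description of the sets `B_i`: a state without outcomes is never degenerate. -/
theorem mem_branchSet_iff (hM : M.det ≠ 0) (hτ : τ ≠ 0)
    (hgram : ∀ x ∈ levelSet ξ, ((gradXi ξ x)ᵀ * M⁻¹ * gradXi ξ x).det ≠ 0) {i : ℕ}
    {z : (Fin d → ℝ) × (Fin d → ℝ)} :
    z ∈ branchSet M ξ V τ i ↔ z ∈ cotangentBundle M ξ \ badSet M ξ V τ ∧
      (outcomes M ξ V τ z).encard = i := by
  cases i with
  | zero =>
    exact ⟨fun h => ⟨⟨h.1, Set.disjoint_left.1 (disjoint_branchSet_badSet hM hτ hgram 0) h⟩, h.2⟩,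
      fun h => ⟨h.1.1, h.2⟩⟩
  | succ i => exact Iff.rfl

theorem isOpen_branchSet (hξ : ContDiff ℝ 2 ξ) (hV : ContDiff ℝ 2 V)
    (hcompact : IsCompact (levelSet ξ)) (hM : M.det ≠ 0) (hτ : τ ≠ 0)
    (hgram : ∀ x ∈ levelSet ξ, ((gradXi ξ x)ᵀ * M⁻¹ * gradXi ξ x).det ≠ 0) (i : ℕ) :
    IsOpen (Subtype.val ⁻¹' branchSet M ξ V τ i : Set (cotangentBundle M ξ)) := by
  refine isOpen_iff_mem_nhds.2 fun z hz => ?_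
  have hz' := (mem_branchSet_iff hM hτ hgram).1 hz
  have hev : ∀ᶠ z' in 𝓝 (z : (Fin d → ℝ) × (Fin d → ℝ)), z' ∈ cotangentBundle M ξ →
      z' ∈ branchSet M ξ V τ i := by
    filter_upwards [eventually_encard_outcomes_eq hξ hV hcompact hM hτ hgram hz'.1,
      (isCompact_badSet hξ hV hcompact hgram).isClosed.isOpen_compl.mem_nhds hz'.1.2]
      with z' h1 h2 h3
    exact (mem_branchSet_iff hM hτ hgram).2 ⟨⟨h3, h2⟩, (h1 h3).trans hz'.2⟩
  filter_upwards [continuous_subtype_val.continuousAt.eventually hev] with z' h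
  exact h z'.2

/-- A function that is `C¹` at every point of an open set is `C¹` on every subset of it. -/
theorem isC1On_of_contDiffAt {E F : Type*} [NormedAddCommGroup E] [NormedSpace ℝ E]
    [NormedAddCommGroup F] [NormedSpace ℝ F] {f : E → F} {U O : Set E} (hU : IsOpen U)
    (hO : O ⊆ U) (hf : ∀ x ∈ U, ContDiffAt ℝ 1 f x) : IsC1On f O :=
  fun _ hz => ⟨U, hU, hO hz, f, fun x hx => (hf x hx).contDiffWithinAt, fun _ _ => rfl⟩

/-- The local `C¹` branches of outcomes, with their multipliers and positions. -/
theorem exists_outcome_branches (hξ : ContDiff ℝ 2 ξ) (hV : ContDiff ℝ 2 V)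
    (hcompact : IsCompact (levelSet ξ)) (hM : M.det ≠ 0) (hτ : τ ≠ 0)
    (hgram : ∀ x ∈ levelSet ξ, ((gradXi ξ x)ᵀ * M⁻¹ * gradXi ξ x).det ≠ 0)
    {z : (Fin d → ℝ) × (Fin d → ℝ)} (hz : z ∈ cotangentBundle M ξ \ badSet M ξ V τ)
    {n : ℕ} {w : Fin n → (Fin d → ℝ) × (Fin d → ℝ)} (hinj : Function.Injective w)
    (hw : outcomes M ξ V τ z = range w) :
    ∃ U : Set ((Fin d → ℝ) × (Fin d → ℝ)), IsOpen U ∧ z ∈ U ∧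
      ∃ O : Set ((Fin d → ℝ) × (Fin d → ℝ)), O = U ∩ cotangentBundle M ξ ∧
      ∃ lx lp : Fin n → (Fin d → ℝ) × (Fin d → ℝ) → (Fin k → ℝ),
        (∀ i, IsC1On (lx i) O ∧ IsC1On (lp i) O) ∧
        (∀ i, ∃ Y : (Fin d → ℝ) × (Fin d → ℝ) → (Fin d → ℝ),
          IsC1On Y O ∧ Y z = (w i).1 ∧
          ∀ z' ∈ O, Y z' ∈ levelSet ξ ∧ GM M ξ V τ z'.1 (Y z') = z'.2 ∧
            lx i z' = multX M ξ V τ z' (Y z') ∧ lp i z' = multP M ξ V τ z' (Y z')) ∧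
        (∀ i, w i = rattleMap M ξ V τ z (lx i z) (lp i z)) ∧
        (∀ z' ∈ O, outcomes M ξ V τ z' =
          Set.range fun i => rattleMap M ξ V τ z' (lx i z') (lp i z')) ∧
        (∀ z' ∈ O, (outcomes M ξ V τ z').encard = (n : ℕ∞)) := by
  have himg := outcomes_eq_image hM hτ hgram hz.1 (V := V)
  have hwmem : ∀ i, ∃ c ∈ multiplierSet M ξ V τ z, outcomeOf M ξ V τ z c = w i := fun i => by
    have : w i ∈ outcomes M ξ V τ z := hw ▸ mem_range_self i
    rwa [himg] at this
  choose c hcmem hcw using hwmem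
  have hcinj : Function.Injective c := fun i j h => hinj (by rw [← hcw, ← hcw, h])
  have hcrange : multiplierSet M ξ V τ z = range c := by
    refine Subset.antisymm (fun c' hc' => ?_) (range_subset_iff.2 hcmem)
    have : outcomeOf M ξ V τ z c' ∈ range w := by
      rw [← hw, himg]
      exact mem_image_of_mem _ hc'
    obtain ⟨i, hi⟩ := this
    exact ⟨i, outcomeOf_injective hM hτ hgram hz.1 ((hcw i).trans hi)⟩
  obtain ⟨l, hl, hev⟩ :=
    exists_multiplier_branches hξ hV hcompact hM hτ hgram hz hcinj hcrange
  let Y : Fin n → (Fin d → ℝ) × (Fin d → ℝ) → (Fin d → ℝ) := fun i z' =>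
    rattlePos M ξ V τ z' (l i z')
  have hY : ∀ i z', ContDiffAt ℝ 1 (l i) z' → ContDiffAt ℝ 1 (Y i) z' := fun i z' h =>
    contDiffAt_rattlePos hξ hV contDiffAt_id h
  have hYz : ∀ i, Y i z ∈ levelSet ξ := fun i => by
    have := hcmem i
    rw [← (hl i).1] at this
    exact this
  let p : Fin n → (Fin d → ℝ) × (Fin d → ℝ) → (Fin k → ℝ) := fun i z' =>
    multP M ξ V τ z' (Y i z')
  have hsmooth : ∀ᶠ z' in 𝓝 z, ∀ i, ContDiffAt ℝ 1 (l i) z' ∧ ContDiffAt ℝ 1 (p i) z' := by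
    refine eventually_all.2 fun i => ?_
    have hp : ContDiffAt ℝ 1 (p i) z := contDiffAt_multP hξ hV contDiffAt_id (hY i z (hl i).2)
      (hgram _ hz.1.1) (hgram _ (hYz i))
    exact ((hl i).2.eventually (by simp)).and (hp.eventually (by simp))
  obtain ⟨U, hUsub, hU, hzU⟩ := eventually_nhds_iff.1 (hev.and hsmooth)
  have hloc : ∀ z' ∈ U ∩ cotangentBundle M ξ, Function.Injective (fun i => l i z') ∧
      multiplierSet M ξ V τ z' = range fun i => l i z' := fun z' hz' => (hUsub z' hz'.1).1 hz'.2
  have hout : ∀ z' ∈ U ∩ cotangentBundle M ξ, outcomes M ξ V τ z' =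
      range fun i => rattleMap M ξ V τ z' (l i z') (p i z') := fun z' hz' => by
    rw [outcomes_eq_image hM hτ hgram hz'.2, (hloc z' hz').2, ← range_comp]
    rfl
  refine ⟨U, hU, hzU, _, rfl, l, p, fun i => ⟨?_, ?_⟩, fun i => ⟨Y i, ?_, ?_, ?_⟩, ?_, hout, ?_⟩
  · exact isC1On_of_contDiffAt hU inter_subset_left fun x hx => ((hUsub x hx).2 i).1
  · exact isC1On_of_contDiffAt hU inter_subset_left fun x hx => ((hUsub x hx).2 i).2
  · exact isC1On_of_contDiffAt hU inter_subset_left fun x hx => hY i x ((hUsub x hx).2 i).1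
  · rw [← hcw i, ← (hl i).1]
    rfl
  · intro z' hz'
    have hmem : l i z' ∈ multiplierSet M ξ V τ z' := by
      rw [(hloc z' hz').2]
      exact mem_range_self i
    exact ⟨hmem, GM_rattlePos hM hτ hgram hz'.2 _,
      (multX_rattlePos hM hτ hz'.2.2 (hgram _ hz'.2.1) _).symm, rfl⟩
  · intro i
    rw [← hcw i, ← (hl i).1]
    rfl
  · intro z' hz'
    rw [outcomes_eq_image hM hτ hgram hz'.2, (outcomeOf_injective hM hτ hgram hz'.2).encard_image,
      (hloc z' hz').2, ← image_univ, (hloc z' hz').1.encard_image, encard_univ]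
    simp

end Branches

end RattleHMC

theorem mainTheorem6 {d k : ℕ} (hk : 1 ≤ k) (hkd : k < d)
    (ξ : (Fin d → ℝ) → (Fin k → ℝ)) (hξ : ContDiff ℝ ((⊤ : ℕ∞) : WithTop ℕ∞) ξ)
    (hcompact : IsCompact (RattleHMC.levelSet ξ))
    (hrank : ∀ x ∈ RattleHMC.levelSet ξ,
      ((RattleHMC.gradXi ξ x)ᵀ * RattleHMC.gradXi ξ x).PosDef)
    (V : (Fin d → ℝ) → ℝ) (hV : ContDiff ℝ 2 V)
    (M : Matrix (Fin d) (Fin d) ℝ) (hM : M.PosDef) (τ : ℝ) (hτ : 0 < τ) :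
    -- 1. `N` is closed in `T*Σ`, of measure zero, and has the alternative description
    (IsClosed (Subtype.val ⁻¹' RattleHMC.badSet M ξ V τ : Set (RattleHMC.cotangentBundle M ξ)) ∧
      RattleHMC.liouvilleMeasure M ξ (RattleHMC.badSet M ξ V τ) = 0 ∧
      RattleHMC.badSet M ξ V τ = {z | z ∈ RattleHMC.cotangentBundle M ξ ∧
        ∃ z' ∈ RattleHMC.outcomes M ξ V τ z,
          ((RattleHMC.gradXi ξ z'.1)ᵀ * M⁻¹ * RattleHMC.gradXi ξ z.1).det = 0}) ∧
    -- 2. finiteness of `𝓕(z)` outside `N`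
    (∀ z ∈ RattleHMC.cotangentBundle M ξ \ RattleHMC.badSet M ξ V τ,
      (RattleHMC.outcomes M ξ V τ z).Finite) ∧
    -- 3. local `C¹` branches of multipliers
    (∀ z ∈ RattleHMC.cotangentBundle M ξ \ RattleHMC.badSet M ξ V τ,
      ∀ n : ℕ, 1 ≤ n → ∀ w : Fin n → (Fin d → ℝ) × (Fin d → ℝ), Function.Injective w →
      RattleHMC.outcomes M ξ V τ z = Set.range w →
      ∃ U : Set ((Fin d → ℝ) × (Fin d → ℝ)), IsOpen U ∧ z ∈ U ∧
      ∃ O : Set ((Fin d → ℝ) × (Fin d → ℝ)), O = U ∩ RattleHMC.cotangentBundle M ξ ∧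
      ∃ lx lp : Fin n → (Fin d → ℝ) × (Fin d → ℝ) → (Fin k → ℝ),
        (∀ i, RattleHMC.IsC1On (lx i) O ∧ RattleHMC.IsC1On (lp i) O) ∧
        -- the multipliers are given by the explicit formulas in terms of a `C¹` position branch
        (∀ i, ∃ Y : (Fin d → ℝ) × (Fin d → ℝ) → (Fin d → ℝ),
          RattleHMC.IsC1On Y O ∧ Y z = (w i).1 ∧
          ∀ z' ∈ O, Y z' ∈ RattleHMC.levelSet ξ ∧ RattleHMC.GM M ξ V τ z'.1 (Y z') = z'.2 ∧
            lx i z' = RattleHMC.multX M ξ V τ z' (Y z') ∧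
            lp i z' = RattleHMC.multP M ξ V τ z' (Y z')) ∧
        (∀ i, w i = RattleHMC.rattleMap M ξ V τ z (lx i z) (lp i z)) ∧
        (∀ z' ∈ O, RattleHMC.outcomes M ξ V τ z' =
          Set.range fun i => RattleHMC.rattleMap M ξ V τ z' (lx i z') (lp i z')) ∧
        (∀ z' ∈ O, (RattleHMC.outcomes M ξ V τ z').encard = (n : ℕ∞))) ∧
    -- 4. `T*Σ` is the disjoint union of `N` and the open sets `B_i`
    (RattleHMC.cotangentBundle M ξ =
        (⋃ i, RattleHMC.branchSet M ξ V τ i) ∪ RattleHMC.badSet M ξ V τ ∧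
      Pairwise (fun i j => Disjoint (RattleHMC.branchSet M ξ V τ i)
        (RattleHMC.branchSet M ξ V τ j)) ∧
      (∀ i, Disjoint (RattleHMC.branchSet M ξ V τ i) (RattleHMC.badSet M ξ V τ)) ∧
      ∀ i, IsOpen (Subtype.val ⁻¹' RattleHMC.branchSet M ξ V τ i :
        Set (RattleHMC.cotangentBundle M ξ))) := by

  have hξ2 : ContDiff ℝ 2 ξ := hξ.of_le (WithTop.coe_le_coe.2 le_top)
  have hMdet : M.det ≠ 0 := hM.det_pos.ne'
  have hτ0 : τ ≠ 0 := hτ.ne'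
  have hgram := fun x hx => RattleHMC.gram_det_ne_zero hM (hrank x hx)
  refine ⟨⟨?_, ?_, ?_⟩, ?_, ?_, ?_, ?_, ?_, ?_⟩
  · exact (RattleHMC.isCompact_badSet hξ2 hV hcompact hgram).isClosed.preimage
      continuous_subtype_val
  · exact RattleHMC.liouvilleMeasure_badSet hξ2 hV hcompact hrank hM
  · exact RattleHMC.badSet_eq_outcomes hMdet hτ0 hgram
  · exact fun z hz => RattleHMC.finite_outcomes hξ2 hV hcompact hMdet hτ0 hgram hz
  · exact fun z hz n _ w hinj hw =>
      RattleHMC.exists_outcome_branches hξ2 hV hcompact hMdet hτ0 hgram hz hinj hw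
  · ext z
    constructor
    · intro hz
      by_cases hbad : z ∈ RattleHMC.badSet M ξ V τ
      · exact Or.inr hbad
      · have hfin := RattleHMC.finite_outcomes hξ2 hV hcompact hMdet hτ0 hgram ⟨hz, hbad⟩
        exact Or.inl (mem_iUnion.2 ⟨_, (RattleHMC.mem_branchSet_iff hMdet hτ0 hgram).2
          ⟨⟨hz, hbad⟩, hfin.cast_ncard_eq.symm⟩⟩)
    · rintro (hz | hz)
      · obtain ⟨i, hi⟩ := mem_iUnion.1 hz
        exact ((RattleHMC.mem_branchSet_iff hMdet hτ0 hgram).1 hi).1.1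
      · exact hz.1
  · intro i j hij
    refine Set.disjoint_left.2 fun z hi hj => hij ?_
    have h1 := ((RattleHMC.mem_branchSet_iff hMdet hτ0 hgram).1 hi).2
    have h2 := ((RattleHMC.mem_branchSet_iff hMdet hτ0 hgram).1 hj).2
    exact_mod_cast h1.symm.trans h2
  · exact RattleHMC.disjoint_branchSet_badSet hMdet hτ0 hgram
  · exact RattleHMC.isOpen_branchSet hξ2 hV hcompact hMdet hτ0 hgram
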